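/- Let $N\ge 1$, $M\ge 1$, $\omega=e^{2\pi i/N}$, $\omega^{1/2}=e^{i\pi/N}$, and let $\sqrt{\cdot}$ be any fixed branch (choice) of the square root on $\mathbb C$. Let $\mathfrak F_M=\{\pi k/M: 1\le k\le M-1\}$ and let $\kappa\in\mathbb C$ satisfy $\kappa\ne 0$, $\kappa^N\neq -1$ and $\kappa^N\ne-\cos^2\phi$ for $\phi\in\mathfrak F_M$. Put $$\Delta_\phi=e^{i\phi}\bigl(\sqrt{\cos^2\phi+\kappa^N}+\cos\phi\bigr),\quad \Delta^*_\phi=e^{-i\phi}\bigl(\sqrt{\cos^2\phi+\kappa^N}+\cos\phi\bigr),\quad \Lambda_\phi=\Delta_\phi\Delta_\phi^*,$$ $$d_{\phi,\phi'}=\frac{(\Delta_\phi-\Delta_{\phi'})(\Delta^*_\phi-\Delta^*_{\phi'})}{(\Delta_\phi-\Delta^*_{\phi'})(\Delta^*_\phi-\Delta_{\phi'})},\qquad s_\phi(\xi)=\frac{\Delta^*_\phi}{\Delta_\phi}\,\frac{\Delta_\phi-\xi}{\Delta^*_\phi-\xi}.$$ Fix pairwise distinct $\phi_1,\dots,\phi_{M-1}\in\mathfrak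 F_M$. Define $\Theta^{(0)}_m=1$ and $$\Theta^{(n)}_m(f_1,\dots,f_n)=\Theta^{(n-1)}_m(f_1,\dots,f_{n-1})-f_ne^{2im\phi_n}\,\Theta^{(n-1)}_m(d_{\phi_1,\phi_n}f_1,\dots,d_{\phi_{n-1},\phi_n}f_{n-1}),$$ and write $\Theta^{(n)}_m\{g\}$ for $\Theta_m^{(n)}$ at $f_k=g_k\prod_{1\le j\le n,\,j\ne k}s_{\phi_k}(\Delta^*_{\phi_j})$. For $0\le n\le M-1$ and $m\in\mathbb Z/M$ let $\tau^{(n)}_m,\theta^{(n)}_m$ be $N$-th roots, with arbitrary phases, $$(\tau_m^{(n)})^N=\Theta_m^{(n)}\{g_k\},\qquad(\theta_m^{(n)})^N=\Theta_m^{(n)}\{g_ks_{\phi_k}(1)\}.$$ Call $(u_m,w_m)_{m\in\mathbb Z/M}$ an $n$-soliton state with amplitudes $g_1,\dots,g_n$ if, for some choice of these phases, $$u_m=-\omega^{-1/2}\,\frac{\tau^{(n)}_{m-1}}{\tau^{(n)}_m},\qquad w_m=-\frac{\theta^{(n)}_m}{\theta^{(n)}_{m-1}}.$$ A $\mathcal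 Q$-transformation with parameters $\kappa_\phi,\lambda_\phi$ sends $(u_m,w_m)_{m\in\mathbb Z/M}$ to $(u'_m,w'_m)_{m\in\mathbb Z/M}$ if there are nonzero $u_{\phi,m},w_{\phi,m}$, $m\in\mathbb Z/M$ (cyclic), with $$u_{\phi,m+1}^N=\frac{\lambda_\phi^Nu_m^N}{\lambda_\phi^N+\kappa^Nu_m^Nw_m^N+w_m^Nu_{\phi,m}^N},\qquad w_{\phi,m+1}^N=\frac{\kappa^N}{\kappa_\phi^N}\frac{u_m^Nw_m^N}{\lambda_\phi^N+w_m^Nu_{\phi,m}^N},$$ $$u_m'^N=\frac{\kappa_\phi^N}{\kappa^N}u_{\phi,m}^N,\qquad w_m'^N=\frac{\kappa^N}{\kappa_\phi^N}\frac{u_m^Nw_m^N}{u_{\phi,m}^N}\frac{w_{\phi,m}^N}{w_{\phi,m+1}^N},$$ all denominators being nonzero. Let $\lambda_{\phi_n}^N=\Lambda_{\phi_n}$ and $\kappa_{\phi_n}^N=\kappa^N/\Delta_{\phi_n}$ for $1\le n\le M-1$. (i) The amplitudes $(g_k)$ for which all $\Theta_m^{(n)}\{g_k\}$ and $\Theta_m^{(n)}\{g_ks_{\phi_k}(1)\}$,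 $0\le n\le M-1$, $m\in\mathbb Z$, are nonzero form an open dense set. (ii) For all such amplitudes, let $(u^{(0)}_m,w^{(0)}_m)=(-\omega^{-1/2},-1)$ be the homogeneous state, and for $1\le n\le M-1$ let $$u_m^{(n)}=-\omega^{-1/2}\,\frac{\tau^{(n)}_{m-1}}{\tau^{(n)}_m},\qquad w_m^{(n)}=-\frac{\theta^{(n)}_m}{\theta^{(n)}_{m-1}},$$ with any choice of phases. Then for every $1\le n\le M-1$ the state $(u^{(n)},w^{(n)})$ is the image of $(u^{(n-1)},w^{(n-1)})$ under a $\mathcal Q$-transformation with parameters $\kappa_{\phi_n},\lambda_{\phi_n}$, and it satisfies $\prod_m(-\omega^{1/2}u_m^{(n)})=\prod_m(-w_m^{(n)})=1$. (iii) The homogeneous state is a $0$-soliton state. Conversely, for $1\le n\le M-1$, let $g_1,\dots,g_{n-1}$ be such that all $\Theta^{(n-1)}_m\{g_k\}$ and $\Theta^{(n-1)}_m\{g_ks_{\phi_k}(1)\}$ are nonzero. Then there is a number $e\in\mathbb C$ such that the following holds for every $(n-1)$-soliton state $(u,w)$ with these amplitudes. Let $(u',w')$ be an image of $(u,w)$ under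 a $\mathcal Q$-transformation with parameters $\kappa_{\phi_n},\lambda_{\phi_n}$, its phases being normalized by $\prod_m(-\omega^{1/2}u'_m)=\prod_m(-w'_m)=1$, and suppose that the auxiliary variable used satisfies $u_{\phi_n,1}^N\neq e$. Then there is exactly one $g_n\in\mathbb C$ such that all $\Theta^{(n)}_m\{g_k\}$ and $\Theta^{(n)}_m\{g_ks_{\phi_k}(1)\}$ are nonzero and $(u',w')$ is an $n$-soliton state with amplitudes $g_1,\dots,g_n$. -/

import Mathlib

open Complex

noncomputable section

namespace TodaChain

/-- The square root `ω^{1/2} = exp(iπ/N)` of the primitive root of unity `ω = exp(2πi/N)`. -/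
def omegaHalf (N : ℕ) : ℂ := exp (I * Real.pi / N)

/-- The set `{π/M, 2π/M, …, (M-1)π/M}` of admissible angles. -/
def angleSet (M : ℕ) : Set ℝ := {x | ∃ k : ℕ, 1 ≤ k ∧ k < M ∧ x = k * Real.pi / M}

section ThetaFunctions

variable (rt : ℂ → ℂ) (K : ℂ)

/-- `Δ_φ = e^{iφ} (√(cos² φ + K) + cos φ)`; here `rt` is the chosen branch of the square root
and `K = κ^N`. -/
def Delta (φ : ℝ) : ℂ := exp (I * φ) * (rt ((Real.cos φ : ℂ) ^ 2 + K) + Real.cos φ)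

/-- `Δ*_φ = e^{-iφ} (√(cos² φ + K) + cos φ)`. -/
def DeltaStar (φ : ℝ) : ℂ := exp (-(I * φ)) * (rt ((Real.cos φ : ℂ) ^ 2 + K) + Real.cos φ)

/-- `Λ_φ = Δ_φ Δ*_φ`. -/
def Lam (φ : ℝ) : ℂ := Delta rt K φ * DeltaStar rt K φ

/-- The phase shift `d_{φ,φ'}`. -/
def phaseShift (φ φ' : ℝ) : ℂ :=
  ((Delta rt K φ - Delta rt K φ') * (DeltaStar rt K φ - DeltaStar rt K φ')) /
    ((Delta rt K φ - DeltaStar rt K φ') * (DeltaStar rt K φ - Delta rt K φ'))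

/-- The function `s_φ(ξ)`. -/
def sFun (φ : ℝ) (ξ : ℂ) : ℂ :=
  DeltaStar rt K φ / Delta rt K φ * ((Delta rt K φ - ξ) / (DeltaStar rt K φ - ξ))

/-- The `n`-solitonic function `Θ_m^{(n)}({f_k, φ_k}_{k=1}^n)`, defined recursively.  Solitons are
numbered from `1`; only `f 1, …, f n` and `φ 1, …, φ n` are used. -/
def Theta (φ : ℕ → ℝ) : ℕ → (ℕ → ℂ) → ℤ → ℂ
  | 0, _, _ => 1
  | n + 1, f, m =>
      Theta φ n f m - f (n + 1) * exp (2 * I * m * φ (n + 1)) *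
        Theta φ n (fun k => phaseShift rt K (φ k) (φ (n + 1)) * f k) m

/-- `f_k^{(n)}({g}) = g_k ∏_{1 ≤ j ≤ n, j ≠ k} s_{k,j}` with `s_{k,j} = s_{φ_k}(Δ*_{φ_j})`. -/
def freeAmplitude (φ : ℕ → ℝ) (n : ℕ) (g : ℕ → ℂ) (k : ℕ) : ℂ :=
  g k * ∏ j ∈ (Finset.Icc 1 n).erase k, sFun rt K (φ k) (DeltaStar rt K (φ j))

/-- `Θ_m^{(n)}({g_k}_{k=1}^n)` in terms of the free amplitudes `g_k`; the `N`-th power of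
`τ_m^{(n)}`. -/
def tauPow (φ : ℕ → ℝ) (n : ℕ) (g : ℕ → ℂ) (m : ℤ) : ℂ :=
  Theta rt K φ n (freeAmplitude rt K φ n g) m

/-- `Θ_m^{(n)}({g_k s_{φ_k}(1)}_{k=1}^n)`; the `N`-th power of `θ_m^{(n)}`. -/
def thetaPow (φ : ℕ → ℝ) (n : ℕ) (g : ℕ → ℂ) (m : ℤ) : ℂ :=
  tauPow rt K φ n (fun k => g k * sFun rt K (φ k) 1) m

/-- No `N`-th power of a `τ_m^{(n)}` or a `θ_m^{(n)}` vanishes. -/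
def NonVanishing (φ : ℕ → ℝ) (n : ℕ) (g : ℕ → ℂ) : Prop :=
  ∀ m : ℤ, tauPow rt K φ n g m ≠ 0 ∧ thetaPow rt K φ n g m ≠ 0

/-- The state `(u_m, w_m)`, `m ∈ ℤ/M`, is `n`-solitonic with amplitudes `g_1, …, g_n`: for some
choice of the phases of `τ_m` and `θ_m` one has `u_m = -ω^{-1/2} τ_{m-1}/τ_m` and
`w_m = -θ_m/θ_{m-1}`. -/
def IsSoliton (N M : ℕ) (φ : ℕ → ℝ) (n : ℕ) (g : ℕ → ℂ) (u w : ZMod M → ℂ) : Prop :=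
  ∃ τ θ : ZMod M → ℂ,
    (∀ m : ℤ, τ (m : ZMod M) ^ N = tauPow rt K φ n g m) ∧
    (∀ m : ℤ, θ (m : ZMod M) ^ N = thetaPow rt K φ n g m) ∧
    (∀ m, u m = -(omegaHalf N)⁻¹ * (τ (m - 1) / τ m)) ∧
    (∀ m, w m = -(θ m / θ (m - 1)))

end ThetaFunctions

/-- `(uφ, wφ)` is a cyclic (`M`-periodic) solution of the auxiliary recursion of the chain with
parameters `(u, w)`, modulus `κ`, and auxiliary parameters `κφ`, `λφ`, and `(u', w')` is the image
of `(u, w)` under the corresponding Darboux (Bäcklund) transformation. All relations are between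
`N`-th powers, i.e. the phases of the variables are free. -/
structure IsQTransformWith (N M : ℕ) (κ κφ lamφ : ℂ) (uφ wφ u w u' w' : ZMod M → ℂ) : Prop where
  uφ_ne : ∀ m, uφ m ≠ 0
  wφ_ne : ∀ m, wφ m ≠ 0
  den_u : ∀ m, lamφ ^ N + κ ^ N * u m ^ N * w m ^ N + w m ^ N * uφ m ^ N ≠ 0
  den_w : ∀ m, lamφ ^ N + w m ^ N * uφ m ^ N ≠ 0
  rec_u : ∀ m, uφ (m + 1) ^ N =
    lamφ ^ N * u m ^ N / (lamφ ^ N + κ ^ N * u m ^ N * w m ^ N + w m ^ N * uφ m ^ N)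
  rec_w : ∀ m, wφ (m + 1) ^ N =
    κ ^ N / κφ ^ N * (u m ^ N * w m ^ N / (lamφ ^ N + w m ^ N * uφ m ^ N))
  out_u : ∀ m, u' m ^ N = κφ ^ N / κ ^ N * uφ m ^ N
  out_w : ∀ m, w' m ^ N =
    κ ^ N / κφ ^ N * (u m ^ N * w m ^ N / uφ m ^ N) * (wφ m ^ N / wφ (m + 1) ^ N)

/-- `(u', w')` is an image of `(u, w)` under a transformation `Q_φ` with parameters `κφ`, `λφ`. -/
def IsQTransform (N M : ℕ) (κ κφ lamφ : ℂ) (u w u' w' : ZMod M → ℂ) : Prop :=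
  ∃ uφ wφ : ZMod M → ℂ, IsQTransformWith N M κ κφ lamφ uφ wφ u w u' w'

/-- The gauge normalization `∏ (-ω^{1/2} u_m) = ∏ (-w_m) = 1`. -/
def IsGaugeFixed (N M : ℕ) [NeZero M] (u w : ZMod M → ℂ) : Prop :=
  ∏ m, (-omegaHalf N * u m) = 1 ∧ ∏ m, (-w m) = 1

end TodaChain

end

/-! Write a = Δ_φ, b = Δ*_φ, K = κ^N. All spectral points lie on the curve ab = a + b + K, that is
(a - 1)(b - 1) = 1 + K, and e^{2iφ} = a/b.

Up to a nonzero constant, Θ_m^{(n)}{g} is the determinant whose i-th row is the moment sequence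
b_i^{-j} - g_i e^{2imφ_i} a_i^{-j}, 0 ≤ j < n (`exists_momentDet_eq_tauPow`). Multiplying these
functionals by 1 - xz replaces g_k by g_k s_{φ_k}(x), and multiplying them by z replaces m by m - 1.
A Plücker relation between determinants bordered by evaluation functionals therefore becomes a
bilinear Fay identity in two free points x, y (`tauPow_fay`).

Since Θ^{(n+1)} is affine in g_{n+1}, with twists at b_{n+1} and a_{n+1} as its two parts
(`tauPow_succ`), the Fay identity at pairs of points from 1, -K, a_{n+1}, b_{n+1} gives two bilinear
relations between n and n + 1 solitons (`bilinear_theta`, `bilinear_tau`). With u_φ^N proportional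
to τ'_{m-1}/τ'_m (N-th powers of τ^{(n+1)}), they turn the denominators of the Q-transformation into
monomials, so that solitonic states solve it.

Conversely, the recursion for u_φ^N is of first order, so the value at one site determines the
cyclic solution. The ratio τ'_0/τ'_1 is a Möbius function of g_{n+1}, nondegenerate because a
Casoratian equals a nonzero multiple of θτ (`casoratian`). Every initial value but one, the image of
g_{n+1} = ∞, thus comes from exactly one amplitude. The gauge normalization finally allows the
passage from N-th powers to τ and θ on the cycle (`exists_phases`). -/

noncomputable section

/-! ### Moment determinants: Plücker relation and Fay identity. -/

namespace TodaChain

/-- The three-term Plücker relation between determinants that share all rows but two. -/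
theorem det_updateRow_plucker {R ι : Type*} [CommRing R] [Fintype ι] [DecidableEq ι]
    (A : Matrix ι ι R) {i j : ι} (hij : i ≠ j) (v₁ v₂ v₃ v₄ : ι → R) :
    ((A.updateRow i v₃).updateRow j v₄).det * ((A.updateRow i v₁).updateRow j v₂).det =
      ((A.updateRow i v₁).updateRow j v₄).det * ((A.updateRow i v₃).updateRow j v₂).det +
      ((A.updateRow i v₃).updateRow j v₁).det * ((A.updateRow i v₄).updateRow j v₂).det := by
  set B := (A.updateRow i v₃).updateRow j v₄ with hB
  let C := A.updateRow j v₂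
  have hC : ∀ v, ((A.updateRow i v).updateRow j v₂) = C.updateRow i v := fun v =>
    Matrix.updateRow_comm A hij.symm v₂ v |>.symm ▸ rfl
  -- Cramer's rule expands `v₁` in the rows of `B`. Put into row `i` of `C`, only `l = i` and `l =
  -- j` survive, because every other row of `B` is also a row of `C`.
  have hcr : ∀ k, B.det * v₁ k = ∑ l, (B.updateRow l v₁).det * B l k := by
    intro k
    have h := congrFun (Matrix.mulVec_cramer B.transpose v₁) k
    simp only [Matrix.mulVec, dotProduct, Matrix.transpose_apply, Matrix.cramer_transpose_apply,
      Matrix.det_transpose, Pi.smul_apply, smul_eq_mul] at h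
    rw [← h]
    exact Finset.sum_congr rfl fun l _ => mul_comm _ _
  have hlin : B.det * (C.updateRow i v₁).det =
      ∑ l, (B.updateRow l v₁).det * (C.updateRow i (B l)).det := by
    have h1 : B.det • v₁ = ∑ l, (B.updateRow l v₁).det • B l := by
      ext k
      simpa [Finset.sum_apply] using hcr k
    let D : (ι → R) →ₗ[R] R := (Matrix.detRowAlternating (R := R)).toMultilinearMap.toLinearMap C i
    have hD : ∀ v, D v = (C.updateRow i v).det := fun v => rfl
    simp only [← hD]
    rw [← smul_eq_mul, ← map_smul, h1, map_sum]
    simp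
  rw [hC, hC, hC, hlin]
  rw [← Finset.sum_subset (Finset.subset_univ {i, j}), Finset.sum_pair hij]
  · have hi : B i = v₃ := by
      rw [hB, Matrix.updateRow_ne hij, Matrix.updateRow_self]
    have hj : B j = v₄ := by rw [hB, Matrix.updateRow_self]
    rw [hi, hj, hB, Matrix.updateRow_comm _ hij.symm, Matrix.updateRow_idem,
      Matrix.updateRow_comm _ hij, Matrix.updateRow_idem]
  · intro l _ hl
    simp only [Finset.mem_insert, Finset.mem_singleton, not_or] at hl
    have hr : B l = C l := by
      rw [hB, Matrix.updateRow_ne hl.2, Matrix.updateRow_ne hl.1]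
      exact (Matrix.updateRow_ne hl.2).symm
    rw [Matrix.det_zero_of_row_eq (M := C.updateRow i (B l)) (i := i) (j := l) (Ne.symm hl.1),
      mul_zero]
    rw [Matrix.updateRow_self, Matrix.updateRow_ne hl.1, hr]

/-- The determinant of the leading `n` moments of the first `n` rows, rows being numbered
from `1`. -/
def momentDet (n : ℕ) (r : ℕ → ℕ → ℂ) : ℂ :=
  (Matrix.of fun i j : Fin n => r (i + 1) j).det

theorem momentDet_congr {n : ℕ} {r r' : ℕ → ℕ → ℂ}
    (h : ∀ i, 1 ≤ i → i ≤ n → ∀ j < n, r i j = r' i j) : momentDet n r = momentDet n r' := by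
  unfold momentDet
  congr 1
  ext i j
  exact h _ (by omega) (by omega) _ j.2

theorem momentDet_smul (n : ℕ) (c : ℕ → ℂ) (r : ℕ → ℕ → ℂ) :
    momentDet n (fun i j => c i * r i j) = (∏ i ∈ Finset.Icc 1 n, c i) * momentDet n r := by
  unfold momentDet
  have h := Matrix.det_mul_column (fun i : Fin n => c (i + 1))
    (Matrix.of fun i j : Fin n => r (i + 1) j)
  rw [show (∏ i ∈ Finset.Icc 1 n, c i) = ∏ i : Fin n, c (i + 1) by
    rw [Fin.prod_univ_eq_prod_range (fun i => c (i + 1)), Finset.range_eq_Ico,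
      Finset.prod_Ico_add' c 0 n 1]
    rfl]
  exact h

/-- The row of `n + 1` moments that represents evaluation at `1 / x`. -/
def evalRow (n : ℕ) (x : ℂ) (j : ℕ) : ℂ := x ^ (n - j)

/-- The row of moments that represents evaluation at `0`. -/
def zeroRow (j : ℕ) : ℂ := if j = 0 then 1 else 0

/-- Multiplication of all functionals by `1 - x z`. -/
def twist (x : ℂ) (r : ℕ → ℕ → ℂ) : ℕ → ℕ → ℂ := fun i j => r i j - x * r i (j + 1)

/-- Multiplication of all functionals by `z`. -/
def shift (r : ℕ → ℕ → ℂ) : ℕ → ℕ → ℂ := fun i j => r i (j + 1)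

/-- Subtracting x times column j + 1 from column j clears the last row except for its final entry
x^0 = 1, and twists all other rows. -/
theorem momentDet_evalRow (n : ℕ) (x : ℂ) (r : ℕ → ℕ → ℂ)
    (hr : ∀ j ≤ n, r (n + 1) j = evalRow n x j) :
    momentDet (n + 1) r = momentDet n (twist x r) := by
  let A : Matrix (Fin (n + 1)) (Fin (n + 1)) ℂ := Matrix.of fun i j => r (i + 1) j
  let B : Matrix (Fin (n + 1)) (Fin (n + 1)) ℂ :=
    Matrix.of fun i j => if (j : ℕ) = n then r (i + 1) j else twist x r (i + 1) j
  have hAB : A.det = B.det := by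
    -- The columns are reversed so that the column to be subtracted becomes the preceding one.
    rw [← Matrix.det_submatrix_equiv_self Fin.revPerm A,
      ← Matrix.det_submatrix_equiv_self Fin.revPerm B]
    refine Matrix.det_eq_of_forall_col_eq_smul_add_pred (fun _ => x) (fun i => ?_) fun i j => ?_
    · simp [A, B, Fin.val_rev]
    · have h1 : n + 1 - (j + 1 + 1) ≠ n := by omega
      have h2 : n + 1 - ((j : ℕ) + 1) = n + 1 - (j + 1 + 1) + 1 := by omega
      simp only [A, B, Matrix.submatrix_apply, Matrix.of_apply, Fin.revPerm_apply, Fin.val_rev,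
        Fin.val_succ, Fin.val_castSucc, h1, if_false, twist, h2]
      ring
  change A.det = _
  rw [hAB, Matrix.det_succ_row _ (Fin.last n), Finset.sum_eq_single (Fin.last n)]
  · have h1 : B (Fin.last n) (Fin.last n) = 1 := by
      simp [B, hr n le_rfl, evalRow]
    rw [h1, Fin.succAbove_last, Fin.val_last, ← two_mul, pow_mul]
    simp only [even_two, Even.neg_pow, one_pow, mul_one, one_mul]
    unfold momentDet
    congr 1
    ext i j
    have : (j : ℕ) ≠ n := j.2.ne
    simp [B, this]
  · intro j _ hj
    have h0 : (j : ℕ) ≠ n := fun h => hj (Fin.ext h)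
    have h1 : n - (j : ℕ) = n - (j + 1) + 1 := by omega
    have h2 : B (Fin.last n) j = 0 := by
      simp only [B, Matrix.of_apply, h0, if_false, twist, Fin.val_last]
      rw [hr _ (by omega), hr _ (by omega), evalRow, evalRow, h1]
      ring
    rw [h2]
    ring
  · simp

theorem momentDet_zeroRow (n : ℕ) (r : ℕ → ℕ → ℂ) (hr : ∀ j ≤ n, r (n + 1) j = zeroRow j) :
    momentDet (n + 1) r = (-1) ^ n * momentDet n (shift r) := by
  unfold momentDet
  rw [Matrix.det_succ_row _ (Fin.last n), Finset.sum_eq_single 0]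
  · rw [Matrix.of_apply, Fin.val_last, Fin.val_zero, hr 0 (Nat.zero_le n), zeroRow, if_pos rfl]
    simp only [add_zero, mul_one]
    congr 2
    ext i j
    simp [shift]
  · intro j _ hj
    have h0 : (j : ℕ) ≠ 0 := fun h => hj (Fin.ext h)
    rw [Matrix.of_apply, Fin.val_last, hr j (by omega), zeroRow, if_neg h0]
    ring
  · simp

/-- The first `n` rows of `r`, followed by the rows `v` and `v'`. -/
def border (n : ℕ) (r : ℕ → ℕ → ℂ) (v v' : ℕ → ℂ) : ℕ → ℕ → ℂ :=
  fun i => if i = n + 1 then v else if i = n + 2 then v' else r i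

theorem momentDet_border_plucker (n : ℕ) (r : ℕ → ℕ → ℂ) (v₁ v₂ v₃ v₄ : ℕ → ℂ) :
    momentDet (n + 2) (border n r v₃ v₄) * momentDet (n + 2) (border n r v₁ v₂) =
      momentDet (n + 2) (border n r v₁ v₄) * momentDet (n + 2) (border n r v₃ v₂) +
      momentDet (n + 2) (border n r v₃ v₁) * momentDet (n + 2) (border n r v₄ v₂) := by
  let A : Matrix (Fin (n + 2)) (Fin (n + 2)) ℂ := Matrix.of fun i j => r (i + 1) j
  let i₀ : Fin (n + 2) := (Fin.last n).castSucc
  have hij : i₀ ≠ Fin.last (n + 1) := (Fin.castSucc_lt_last _).ne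
  have key : ∀ v v' : ℕ → ℂ, momentDet (n + 2) (border n r v v') =
      ((A.updateRow i₀ fun j => v j).updateRow (Fin.last (n + 1)) fun j => v' j).det := by
    intro v v'
    unfold momentDet
    congr 1
    ext i j
    simp only [Matrix.updateRow_apply, Matrix.of_apply, A, border, Fin.ext_iff, Fin.val_last, i₀,
      Fin.val_castSucc]
    split_ifs <;> first | rfl | omega
  simp only [key]
  exact det_updateRow_plucker A hij _ _ _ _

theorem twist_twist_comm (x y : ℂ) (r : ℕ → ℕ → ℂ) : twist x (twist y r) = twist y (twist x r) := by
  funext i j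
  simp only [twist]
  ring

/-- Eliminating the last row twists the row above it: x^{n+1-j} - y x^{n-j} = (x - y) x^{n-j}, again
an evaluation row, which can be eliminated in turn. -/
theorem momentDet_border_evalRow (n : ℕ) (x y : ℂ) (r : ℕ → ℕ → ℂ) :
    momentDet (n + 2) (border n r (evalRow (n + 1) x) (evalRow (n + 1) y)) =
      (x - y) * momentDet n (twist x (twist y r)) := by
  rw [momentDet_evalRow (n + 1) y _ fun j _ => by simp [border]]
  have h := momentDet_smul (n + 1) (fun i => if i = n + 1 then x - y else 1)
    (fun i => if i = n + 1 then evalRow n x else twist y r i)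
  rw [Finset.prod_ite_eq' _ (n + 1), if_pos (by simp)] at h
  rw [momentDet_evalRow n x (fun i => if i = n + 1 then evalRow n x else twist y r i)
    fun j _ => by simp] at h
  convert h using 1
  · refine momentDet_congr fun i _ hi j hj => ?_
    by_cases hin : i = n + 1
    · have h1 : n + 1 - j = n - j + 1 := by omega
      have h2 : n + 1 - (j + 1) = n - j := by omega
      simp only [twist, border, hin, if_true, evalRow, h1, h2]
      ring
    · have h3 : i ≠ n + 2 := by omega
      simp [twist, border, hin, h3]
  · congr 1
    refine momentDet_congr fun i _ hi j hj => ?_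
    have h1 : i ≠ n + 1 := by omega
    simp [twist, h1]

theorem momentDet_border_zeroRow (n : ℕ) (y : ℂ) (r : ℕ → ℕ → ℂ) :
    momentDet (n + 2) (border n r zeroRow (evalRow (n + 1) y)) =
      (-1) ^ n * momentDet n (shift (twist y r)) := by
  rw [momentDet_evalRow (n + 1) y _ fun j _ => by simp [border],
    momentDet_zeroRow n _ fun j _ => by simp [border, twist, zeroRow]]
  congr 1
  refine momentDet_congr fun i _ hi j hj => ?_
  have h1 : i ≠ n + 1 := by omega
  have h2 : i ≠ n + 2 := by omega
  simp [shift, twist, border, h1, h2]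

theorem twist_zero (r : ℕ → ℕ → ℂ) : twist 0 r = r := by
  funext i j
  simp [twist]

/-- The bilinear Fay identity for moment determinants. -/
theorem momentDet_fay (n : ℕ) (x y : ℂ) (r : ℕ → ℕ → ℂ) :
    (x - y) * (momentDet n (twist x (twist y r)) * momentDet n (shift r)) =
      x * (momentDet n (shift (twist y r)) * momentDet n (twist x r)) -
      y * (momentDet n (shift (twist x r)) * momentDet n (twist y r)) := by
  -- The four bordering functionals are evaluations at 1/x, at infinity (parameter 0, the top
  -- moment), at 0 and at 1/y.
  have h := momentDet_border_plucker n r (evalRow (n + 1) x) (evalRow (n + 1) 0) zeroRow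
    (evalRow (n + 1) y)
  simp only [momentDet_border_evalRow, momentDet_border_zeroRow, twist_zero, sub_zero] at h
  have h1 : ((-1 : ℂ) ^ n) ≠ 0 := by simp
  apply mul_left_cancel₀ h1
  linear_combination -h

/-- A determinant whose last row is a combination of two evaluations. -/
theorem momentDet_two_evalRow (n : ℕ) (x y c d : ℂ) (r : ℕ → ℕ → ℂ)
    (hr : ∀ j ≤ n, r (n + 1) j = c * evalRow n x j + d * evalRow n y j) :
    momentDet (n + 1) r = c * momentDet n (twist x r) + d * momentDet n (twist y r) := by
  have hupd : ∀ z, momentDet n (twist z r) =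
      ((Matrix.of fun i j : Fin (n + 1) => r (i + 1) j).updateRow (Fin.last n)
        fun j => evalRow n z j).det := by
    intro z
    have h1 : momentDet n (twist z r) =
        momentDet n (twist z fun i => if i = n + 1 then evalRow n z else r i) := by
      refine momentDet_congr fun i _ hi j hj => ?_
      have h1 : i ≠ n + 1 := by omega
      simp [twist, h1]
    rw [h1, ← momentDet_evalRow n z _ fun j _ => by simp]
    unfold momentDet
    congr 1
    ext i j
    simp only [Matrix.updateRow_apply, Matrix.of_apply, Fin.ext_iff, Fin.val_last,
      add_left_inj]
    split_ifs <;> rfl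
  rw [hupd, hupd, ← Matrix.det_updateRow_smul, ← Matrix.det_updateRow_smul,
    ← Matrix.det_updateRow_add]
  unfold momentDet
  congr 1
  ext i j
  by_cases hi : i = Fin.last n
  · subst hi
    simp only [Matrix.updateRow_self, Matrix.of_apply, Fin.val_last, Pi.add_apply, Pi.smul_apply,
      smul_eq_mul]
    exact hr j (by omega)
  · rw [Matrix.updateRow_ne hi]

/-! ### Solitonic functions as moment determinants. -/

section

variable {rt : ℂ → ℂ} {K : ℂ} {φ : ℕ → ℝ}

/-- The spectral points `Δ_{φ_k}`, `Δ*_{φ_k}`, `1 ≤ k ≤ n`, lie on the curve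
`ΔΔ* = Δ + Δ* + K` and are in general position. -/
structure Generic (rt : ℂ → ℂ) (K : ℂ) (φ : ℕ → ℝ) (n : ℕ) : Prop where
  delta_ne : ∀ k ∈ Finset.Icc 1 n, Delta rt K (φ k) ≠ 0
  star_ne : ∀ k ∈ Finset.Icc 1 n, DeltaStar rt K (φ k) ≠ 0
  curve : ∀ k ∈ Finset.Icc 1 n, Delta rt K (φ k) * DeltaStar rt K (φ k) =
    Delta rt K (φ k) + DeltaStar rt K (φ k) + K
  K_ne : K ≠ -1
  star_inj : ∀ j ∈ Finset.Icc 1 n, ∀ k ∈ Finset.Icc 1 n, j ≠ k →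
    DeltaStar rt K (φ j) ≠ DeltaStar rt K (φ k)
  delta_ne_star : ∀ j ∈ Finset.Icc 1 n, ∀ k ∈ Finset.Icc 1 n,
    Delta rt K (φ j) ≠ DeltaStar rt K (φ k)
  exp_eq : ∀ k ∈ Finset.Icc 1 n, exp (2 * I * φ k) = Delta rt K (φ k) / DeltaStar rt K (φ k)

theorem Generic.mono {m n : ℕ} (h : Generic rt K φ n) (hmn : m ≤ n) : Generic rt K φ m := by
  have hs : ∀ k ∈ Finset.Icc 1 m, k ∈ Finset.Icc 1 n := fun k hk =>
    Finset.Icc_subset_Icc_right hmn hk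
  exact ⟨fun k hk => h.1 k (hs k hk), fun k hk => h.2 k (hs k hk), fun k hk => h.3 k (hs k hk),
    h.4, fun j hj k hk => h.5 j (hs j hj) k (hs k hk), fun j hj k hk => h.6 j (hs j hj) k (hs k hk),
    fun k hk => h.7 k (hs k hk)⟩

theorem Generic.star_ne_one {n : ℕ} (h : Generic rt K φ n) {k : ℕ} (hk : k ∈ Finset.Icc 1 n) :
    DeltaStar rt K (φ k) ≠ 1 := by
  intro h1
  have h2 := h.curve k hk
  rw [h1] at h2
  exact h.K_ne (by linear_combination -h2)

theorem Generic.star_ne_neg {n : ℕ} (h : Generic rt K φ n) {k : ℕ} (hk : k ∈ Finset.Icc 1 n) :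
    DeltaStar rt K (φ k) ≠ -K := by
  intro h1
  have h2 : Delta rt K (φ k) * (DeltaStar rt K (φ k) - 1) = 0 := by
    linear_combination h.curve k hk + h1
  exact mul_ne_zero (h.delta_ne k hk) (sub_ne_zero.2 (h.star_ne_one hk)) h2

theorem exp_int_eq (m : ℤ) (x : ℝ) : exp (2 * I * m * x) = exp (2 * I * x) ^ m := by
  rw [← exp_int_mul]
  ring_nf

theorem Theta_congr {n : ℕ} {f f' : ℕ → ℂ} (m : ℤ) (h : ∀ k ∈ Finset.Icc 1 n, f k = f' k) :
    Theta rt K φ n f m = Theta rt K φ n f' m := by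
  induction n generalizing f f' with
  | zero => rfl
  | succ n ih =>
    have hs : ∀ k ∈ Finset.Icc 1 n, k ∈ Finset.Icc 1 (n + 1) := fun k hk =>
      Finset.Icc_subset_Icc_right (Nat.le_succ n) hk
    rw [Theta, Theta, h (n + 1) (by simp), ih (f := f) fun k hk => h k (hs k hk),
      ih (f := fun k => phaseShift rt K (φ k) (φ (n + 1)) * f k)
        (f' := fun k => phaseShift rt K (φ k) (φ (n + 1)) * f' k)
        fun k hk => by rw [h k (hs k hk)]]

theorem tauPow_congr {n : ℕ} {g g' : ℕ → ℂ} (m : ℤ) (h : ∀ k ∈ Finset.Icc 1 n, g k = g' k) :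
    tauPow rt K φ n g m = tauPow rt K φ n g' m :=
  Theta_congr m fun k hk => by rw [freeAmplitude, freeAmplitude, h k hk]

theorem Theta_mul_exp (n : ℕ) (f : ℕ → ℂ) (l m : ℤ) :
    Theta rt K φ n (fun k => f k * exp (2 * I * φ k) ^ l) m = Theta rt K φ n f (m + l) := by
  induction n generalizing f with
  | zero => rfl
  | succ n ih =>
    have h1 : Theta rt K φ n (fun k => phaseShift rt K (φ k) (φ (n + 1)) *
        (f k * exp (2 * I * φ k) ^ l)) m =
        Theta rt K φ n (fun k => phaseShift rt K (φ k) (φ (n + 1)) * f k) (m + l) := by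
      rw [← ih]
      exact Theta_congr m fun k _ => by ring
    rw [Theta, Theta, ih, h1, exp_int_eq, exp_int_eq, zpow_add₀ (exp_ne_zero _)]
    ring

theorem tauPow_mul_exp (n : ℕ) (g : ℕ → ℂ) (l m : ℤ) :
    tauPow rt K φ n (fun k => g k * exp (2 * I * φ k) ^ l) m = tauPow rt K φ n g (m + l) := by
  rw [tauPow, tauPow, ← Theta_mul_exp]
  exact Theta_congr m fun k _ => by rw [freeAmplitude, freeAmplitude]; ring

/-- The effect of the solitons `1, …, n` on the amplitude of a further soliton. -/
def ampFactor (rt : ℂ → ℂ) (K : ℂ) (φ : ℕ → ℝ) (n : ℕ) : ℂ :=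
  ∏ j ∈ Finset.Icc 1 n, sFun rt K (φ (n + 1)) (DeltaStar rt K (φ j))

theorem ampFactor_ne_zero {n : ℕ} (h : Generic rt K φ (n + 1)) : ampFactor rt K φ n ≠ 0 := by
  have hn : n + 1 ∈ Finset.Icc 1 (n + 1) := by simp
  refine Finset.prod_ne_zero_iff.2 fun j hj => ?_
  have hj' := Finset.Icc_subset_Icc_right (Nat.le_succ n) hj
  have hne : n + 1 ≠ j := by
    rw [Finset.mem_Icc] at hj
    omega
  exact mul_ne_zero (div_ne_zero (h.star_ne _ hn) (h.delta_ne _ hn))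
    (div_ne_zero (sub_ne_zero.2 (h.delta_ne_star _ hn _ hj'))
      (sub_ne_zero.2 (h.star_inj _ hn _ hj' hne)))

/-- The phase shift is a quotient of twists, d_{φ_k,φ_{n+1}} = s_{φ_k}(Δ_{φ_{n+1}}) /
s_{φ_k}(Δ*_{φ_{n+1}}). So it exchanges the factor s_{φ_k}(Δ*_{φ_{n+1}}), already present in the free
amplitude, for s_{φ_k}(Δ_{φ_{n+1}}). -/
theorem tauPow_succ {n : ℕ} (h : Generic rt K φ (n + 1)) (g : ℕ → ℂ) (m : ℤ) :
    tauPow rt K φ (n + 1) g m =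
      tauPow rt K φ n (fun k => g k * sFun rt K (φ k) (DeltaStar rt K (φ (n + 1)))) m -
      g (n + 1) * ampFactor rt K φ n * exp (2 * I * φ (n + 1)) ^ m *
        tauPow rt K φ n (fun k => g k * sFun rt K (φ k) (Delta rt K (φ (n + 1)))) m := by
  have hn : n + 1 ∈ Finset.Icc 1 (n + 1) := by simp
  have hfree : ∀ k ∈ Finset.Icc 1 n, freeAmplitude rt K φ (n + 1) g k =
      freeAmplitude rt K φ n
        (fun k => g k * sFun rt K (φ k) (DeltaStar rt K (φ (n + 1)))) k := by
    intro k hk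
    have hk' : n + 1 ≠ k := by
      rw [Finset.mem_Icc] at hk
      omega
    rw [freeAmplitude, freeAmplitude, ← Finset.insert_Icc_right_eq_Icc_add_one (by omega),
      Finset.erase_insert_of_ne hk', Finset.prod_insert (by simp)]
    ring
  have hlast : freeAmplitude rt K φ (n + 1) g (n + 1) = g (n + 1) * ampFactor rt K φ n := by
    rw [freeAmplitude, ampFactor, ← Finset.insert_Icc_right_eq_Icc_add_one (by omega),
      Finset.erase_insert (by simp)]
  rw [tauPow, Theta, exp_int_eq, hlast, Theta_congr m hfree, tauPow, tauPow]
  congr 2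
  refine Theta_congr m fun k hk => ?_
  have hk' := Finset.Icc_subset_Icc_right (Nat.le_succ n) hk
  have hkn : k ≠ n + 1 := by
    rw [Finset.mem_Icc] at hk
    omega
  rw [hfree k hk, freeAmplitude, freeAmplitude, phaseShift]
  simp only [sFun]
  have h1 := sub_ne_zero.2 (h.delta_ne_star k hk' _ hn)
  have h2 := sub_ne_zero.2 (h.star_inj k hk' _ hn hkn)
  have h3 := sub_ne_zero.2 (h.delta_ne_star _ hn k hk').symm
  have h4 := h.delta_ne k hk'
  field_simp

/-- The rows of the determinant representation of the solitonic functions. -/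
def solitonRow (rt : ℂ → ℂ) (K : ℂ) (φ : ℕ → ℝ) (g : ℕ → ℂ) (m : ℤ) (i j : ℕ) : ℂ :=
  (DeltaStar rt K (φ i))⁻¹ ^ j -
    g i * exp (2 * I * φ i) ^ m * (Delta rt K (φ i))⁻¹ ^ j

/-- The two geometric sequences in the row are scaled by 1 - x/Δ* and 1 - x/Δ; the second factor
divided by the first is s_φ(x). -/
theorem twist_solitonRow {n : ℕ} (h : Generic rt K φ n) {x : ℂ}
    (hx : ∀ k ∈ Finset.Icc 1 n, DeltaStar rt K (φ k) ≠ x) (g : ℕ → ℂ) (m : ℤ) {i : ℕ}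
    (hi : i ∈ Finset.Icc 1 n) (j : ℕ) :
    solitonRow rt K φ g m i j - x * solitonRow rt K φ g m i (j + 1) =
      (1 - x / DeltaStar rt K (φ i)) *
        solitonRow rt K φ (fun k => g k * sFun rt K (φ k) x) m i j := by
  have ha := h.delta_ne i hi
  have hb := h.star_ne i hi
  have hbx := sub_ne_zero.2 (hx i hi)
  simp only [solitonRow, sFun, pow_succ]
  generalize (DeltaStar rt K (φ i))⁻¹ ^ j = B
  generalize (Delta rt K (φ i))⁻¹ ^ j = A
  field_simp
  ring

/-- The two sequences are scaled by 1/Δ* and 1/Δ, whose relative factor Δ*/Δ = e^{-2iφ} lowers m by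
one. -/
theorem shift_solitonRow {n : ℕ} (h : Generic rt K φ n) (g : ℕ → ℂ) (m : ℤ) {i : ℕ}
    (hi : i ∈ Finset.Icc 1 n) (j : ℕ) :
    solitonRow rt K φ g m i (j + 1) =
      (DeltaStar rt K (φ i))⁻¹ * solitonRow rt K φ g (m - 1) i j := by
  have ha := h.delta_ne i hi
  have hb := h.star_ne i hi
  simp only [solitonRow, pow_succ]
  rw [zpow_sub_one₀ (exp_ne_zero _)]
  rw [h.exp_eq i hi]
  field_simp

theorem momentDet_twist_solitonRow {n : ℕ} (h : Generic rt K φ n) {x : ℂ}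
    (hx : ∀ k ∈ Finset.Icc 1 n, DeltaStar rt K (φ k) ≠ x) (g : ℕ → ℂ) (m : ℤ) :
    momentDet n (twist x (solitonRow rt K φ g m)) =
      (∏ k ∈ Finset.Icc 1 n, (1 - x / DeltaStar rt K (φ k))) *
        momentDet n (solitonRow rt K φ (fun k => g k * sFun rt K (φ k) x) m) := by
  rw [← momentDet_smul]
  exact momentDet_congr fun i h1 h2 j _ => twist_solitonRow h hx g m (Finset.mem_Icc.2 ⟨h1, h2⟩) j

theorem momentDet_shift_solitonRow {n : ℕ} (h : Generic rt K φ n) (g : ℕ → ℂ) (m : ℤ) :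
    momentDet n (shift (solitonRow rt K φ g m)) =
      (∏ k ∈ Finset.Icc 1 n, (DeltaStar rt K (φ k))⁻¹) *
        momentDet n (solitonRow rt K φ g (m - 1)) := by
  rw [← momentDet_smul]
  exact momentDet_congr fun i h1 h2 j _ => shift_solitonRow h g m (Finset.mem_Icc.2 ⟨h1, h2⟩) j

theorem momentDet_shift_twist_solitonRow {n : ℕ} (h : Generic rt K φ n) {x : ℂ}
    (hx : ∀ k ∈ Finset.Icc 1 n, DeltaStar rt K (φ k) ≠ x) (g : ℕ → ℂ) (m : ℤ) :
    momentDet n (shift (twist x (solitonRow rt K φ g m))) =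
      (∏ k ∈ Finset.Icc 1 n, (1 - x / DeltaStar rt K (φ k))) *
        ((∏ k ∈ Finset.Icc 1 n, (DeltaStar rt K (φ k))⁻¹) *
          momentDet n (solitonRow rt K φ (fun k => g k * sFun rt K (φ k) x) (m - 1))) := by
  rw [← momentDet_smul, ← momentDet_smul]
  refine momentDet_congr fun i h1 h2 j _ => ?_
  have hi := Finset.mem_Icc.2 ⟨h1, h2⟩
  rw [shift, twist, twist_solitonRow h hx g m hi, shift_solitonRow h _ m hi]

theorem momentDet_twist_twist_solitonRow {n : ℕ} (h : Generic rt K φ n) {x y : ℂ}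
    (hx : ∀ k ∈ Finset.Icc 1 n, DeltaStar rt K (φ k) ≠ x)
    (hy : ∀ k ∈ Finset.Icc 1 n, DeltaStar rt K (φ k) ≠ y) (g : ℕ → ℂ) (m : ℤ) :
    momentDet n (twist x (twist y (solitonRow rt K φ g m))) =
      (∏ k ∈ Finset.Icc 1 n, (1 - x / DeltaStar rt K (φ k))) *
        ((∏ k ∈ Finset.Icc 1 n, (1 - y / DeltaStar rt K (φ k))) *
          momentDet n (solitonRow rt K φ
            (fun k => g k * sFun rt K (φ k) y * sFun rt K (φ k) x) m)) := by
  rw [← momentDet_smul, ← momentDet_smul]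
  refine momentDet_congr fun i h1 h2 j _ => ?_
  have hi := Finset.mem_Icc.2 ⟨h1, h2⟩
  have hxr := twist_solitonRow h hx (fun k => g k * sFun rt K (φ k) y) m hi j
  simp only [twist, twist_solitonRow h hy g m hi]
  linear_combination (1 - y / DeltaStar rt K (φ i)) * hxr

theorem prod_one_sub_div_ne_zero {n : ℕ} (h : Generic rt K φ n) {x : ℂ}
    (hx : ∀ k ∈ Finset.Icc 1 n, DeltaStar rt K (φ k) ≠ x) :
    ∏ k ∈ Finset.Icc 1 n, (1 - x / DeltaStar rt K (φ k)) ≠ 0 :=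
  Finset.prod_ne_zero_iff.2 fun k hk => by
    rw [sub_ne_zero]
    intro h1
    exact hx k hk (by rw [eq_div_iff (h.star_ne k hk)] at h1; simpa using h1)

/-- By induction: the last row combines two evaluation rows, with parameters Δ* and Δ, so the
determinant splits into the first n rows twisted at these two points, just as in `tauPow_succ`. The
constant depends neither on g nor on m. -/
theorem exists_momentDet_eq_tauPow {n : ℕ} (h : Generic rt K φ n) :
    ∃ V : ℂ, V ≠ 0 ∧ ∀ g m, momentDet n (solitonRow rt K φ g m) = V * tauPow rt K φ n g m := by
  induction n with
  | zero => exact ⟨1, one_ne_zero, fun g m => by simp [momentDet, tauPow, Theta]⟩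
  | succ n ih =>
    obtain ⟨V, hV, hVt⟩ := ih (h.mono n.le_succ)
    have hn : n + 1 ∈ Finset.Icc 1 (n + 1) := by simp
    have hsub : ∀ k ∈ Finset.Icc 1 n, k ∈ Finset.Icc 1 (n + 1) := fun k hk =>
      Finset.Icc_subset_Icc_right n.le_succ hk
    have hlt : ∀ k ∈ Finset.Icc 1 n, k ≠ n + 1 := fun k hk => by
      rw [Finset.mem_Icc] at hk
      omega
    set a := Delta rt K (φ (n + 1)) with ha
    set b := DeltaStar rt K (φ (n + 1)) with hb
    have ha0 : a ≠ 0 := h.delta_ne _ hn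
    have hb0 : b ≠ 0 := h.star_ne _ hn
    have hbne : ∀ k ∈ Finset.Icc 1 n, DeltaStar rt K (φ k) ≠ b := fun k hk =>
      h.star_inj k (hsub k hk) _ hn (hlt k hk)
    have hane : ∀ k ∈ Finset.Icc 1 n, DeltaStar rt K (φ k) ≠ a := fun k hk =>
      (h.delta_ne_star _ hn k (hsub k hk)).symm
    set P := ∏ k ∈ Finset.Icc 1 n, (1 - b / DeltaStar rt K (φ k)) with hP
    set Q := ∏ k ∈ Finset.Icc 1 n, (1 - a / DeltaStar rt K (φ k)) with hQ
    have hP0 : P ≠ 0 := prod_one_sub_div_ne_zero (h.mono n.le_succ) hbne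
    -- The relative weight of the two twisted determinants is exactly `ampFactor`, so one constant
    -- serves both terms.
    have hPQ : a⁻¹ ^ n * Q = b⁻¹ ^ n * P * ampFactor rt K φ n := by
      have hc : ∀ z : ℂ, z ^ n = ∏ _k ∈ Finset.Icc 1 n, z := by simp
      rw [hc, hc, hP, hQ, ampFactor, ← Finset.prod_mul_distrib, ← Finset.prod_mul_distrib,
        ← Finset.prod_mul_distrib]
      refine Finset.prod_congr rfl fun k hk => ?_
      have h1 := h.star_ne k (hsub k hk)
      have h2 := sub_ne_zero.2 (hbne k hk).symm
      simp only [sFun, ← ha, ← hb]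
      field_simp
      ring
    refine ⟨b⁻¹ ^ n * P * V, by simp [hb0, hP0, hV], fun g m => ?_⟩
    have hinv : ∀ z : ℂ, z ≠ 0 → ∀ j ≤ n, z⁻¹ ^ j = z⁻¹ ^ n * z ^ (n - j) := by
      intro z hz j hj
      rw [pow_sub₀ z hz hj, inv_pow, inv_pow]
      field_simp
    rw [momentDet_two_evalRow n b a (b⁻¹ ^ n)
      (-(g (n + 1) * exp (2 * I * φ (n + 1)) ^ m * a⁻¹ ^ n)) _ fun j hj => by
        rw [solitonRow, ← ha, ← hb, hinv a ha0 j hj, hinv b hb0 j hj, evalRow, evalRow]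
        ring,
      momentDet_twist_solitonRow (h.mono n.le_succ) hbne,
      momentDet_twist_solitonRow (h.mono n.le_succ) hane, hVt, hVt, tauPow_succ h,
      ← ha, ← hb, ← hP, ← hQ]
    linear_combination -(g (n + 1) * exp (2 * I * φ (n + 1)) ^ m * V * tauPow rt K φ n
      (fun k => g k * sFun rt K (φ k) a) m) * hPQ

/-- The bilinear Fay identity for the solitonic functions. -/
theorem tauPow_fay {n : ℕ} (h : Generic rt K φ n) {x y : ℂ}
    (hx : ∀ k ∈ Finset.Icc 1 n, DeltaStar rt K (φ k) ≠ x)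
    (hy : ∀ k ∈ Finset.Icc 1 n, DeltaStar rt K (φ k) ≠ y) (g : ℕ → ℂ) (m : ℤ) :
    (x - y) * (tauPow rt K φ n (fun k => g k * sFun rt K (φ k) x * sFun rt K (φ k) y) m *
        tauPow rt K φ n g (m - 1)) =
      x * (tauPow rt K φ n (fun k => g k * sFun rt K (φ k) y) (m - 1) *
        tauPow rt K φ n (fun k => g k * sFun rt K (φ k) x) m) -
      y * (tauPow rt K φ n (fun k => g k * sFun rt K (φ k) x) (m - 1) *
        tauPow rt K φ n (fun k => g k * sFun rt K (φ k) y) m) := by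
  obtain ⟨V, hV, hVt⟩ := exists_momentDet_eq_tauPow h
  have key := momentDet_fay n x y (solitonRow rt K φ g m)
  have hcomm := twist_twist_comm x y (solitonRow rt K φ g m)
  rw [hcomm, momentDet_twist_twist_solitonRow h hy hx, momentDet_shift_twist_solitonRow h hx,
    momentDet_shift_twist_solitonRow h hy, momentDet_twist_solitonRow h hx,
    momentDet_twist_solitonRow h hy, momentDet_shift_solitonRow h] at key
  simp only [hVt] at key
  have hB : ∏ k ∈ Finset.Icc 1 n, (DeltaStar rt K (φ k))⁻¹ ≠ 0 :=
    Finset.prod_ne_zero_iff.2 fun k hk => inv_ne_zero (h.star_ne k hk)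
  apply mul_left_cancel₀ (mul_ne_zero (mul_ne_zero (mul_ne_zero hV hV) hB)
    (mul_ne_zero (prod_one_sub_div_ne_zero h hx) (prod_one_sub_div_ne_zero h hy)))
  linear_combination key

end

/-! ### Bilinear relations between n and n + 1 solitons. -/

section
variable {rt : ℂ → ℂ} {K : ℂ} {φ : ℕ → ℝ}

/-- On the curve Δ + K = Δ*(Δ - 1) and Δ* + K = Δ(Δ* - 1). Hence twisting at -K is twisting at 1
combined with a step m → m - 1. -/
theorem Generic.sFun_neg {n k : ℕ} (h : Generic rt K φ n) (hk : k ∈ Finset.Icc 1 n) :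
    sFun rt K (φ k) (-K) = sFun rt K (φ k) 1 * exp (2 * I * φ k) ^ (-1 : ℤ) := by
  have ha := h.delta_ne k hk
  have hb := h.star_ne k hk
  have hb1 := sub_ne_zero.2 (h.star_ne_one hk)
  have hbK := sub_ne_zero.2 (h.star_ne_neg hk)
  have hc := h.curve k hk
  rw [zpow_neg_one, h.exp_eq k hk, sFun, sFun]
  have h1 : Delta rt K (φ k) - -K = DeltaStar rt K (φ k) * (Delta rt K (φ k) - 1) := by
    linear_combination -hc
  have h2 : DeltaStar rt K (φ k) - -K = Delta rt K (φ k) * (DeltaStar rt K (φ k) - 1) := by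
    linear_combination -hc
  rw [h1, h2]
  field_simp

/-- By the curve equations (a - a')(a - b') = (a - 1)(ab - a'b'), and likewise with b in place of
the free a; the factor ab - a'b' drops out of the quotient. -/
theorem Generic.sFun_mul_sFun {n k l : ℕ} (h : Generic rt K φ n) (hk : k ∈ Finset.Icc 1 n)
    (hl : l ∈ Finset.Icc 1 n) (hkl : k ≠ l) :
    sFun rt K (φ k) (DeltaStar rt K (φ l)) * sFun rt K (φ k) (Delta rt K (φ l)) =
      sFun rt K (φ k) 1 * exp (2 * I * φ k) ^ (-1 : ℤ) := by
  have ha := h.delta_ne k hk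
  have hb := h.star_ne k hk
  have hb1 := sub_ne_zero.2 (h.star_ne_one hk)
  have hbb := sub_ne_zero.2 (h.star_inj k hk l hl hkl)
  have hba := sub_ne_zero.2 (h.delta_ne_star l hl k hk).symm
  have hc := h.curve k hk
  have hc' := h.curve l hl
  rw [zpow_neg_one, h.exp_eq k hk, sFun, sFun, sFun]
  generalize Delta rt K (φ k) = a at *
  generalize DeltaStar rt K (φ k) = b at *
  generalize Delta rt K (φ l) = a' at *
  generalize DeltaStar rt K (φ l) = b' at *
  have h1 : (a - a') * (a - b') = (a - 1) * (a * b - a' * b') := by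
    linear_combination a * hc' - a * hc
  have h2 : (b - a') * (b - b') = (b - 1) * (a * b - a' * b') := by
    linear_combination b * hc' - b * hc
  field_simp
  linear_combination (b - 1) * h1 - (a - 1) * h2

theorem tauPow_mul_sFun_neg {n : ℕ} (h : Generic rt K φ n) (g : ℕ → ℂ) (m : ℤ) :
    tauPow rt K φ n (fun k => g k * sFun rt K (φ k) (-K)) m = thetaPow rt K φ n g (m - 1) := by
  rw [thetaPow, sub_eq_add_neg, ← tauPow_mul_exp]
  exact tauPow_congr m fun k hk => by rw [h.sFun_neg hk]; ring

theorem Generic.sFun_one_mul {n k : ℕ} (h : Generic rt K φ n) (hk : k ∈ Finset.Icc 1 n) :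
    (DeltaStar rt K (φ k) - 1) * sFun rt K (φ k) 1 =
      DeltaStar rt K (φ k) / Delta rt K (φ k) * (Delta rt K (φ k) - 1) := by
  have ha := h.delta_ne k hk
  have hb1 := sub_ne_zero.2 (h.star_ne_one hk)
  rw [sFun]
  field_simp

theorem Generic.star_ne_star_last {n : ℕ} (h : Generic rt K φ (n + 1)) :
    ∀ k ∈ Finset.Icc 1 n, DeltaStar rt K (φ k) ≠ DeltaStar rt K (φ (n + 1)) := fun k hk =>
  h.star_inj k (Finset.Icc_subset_Icc_right n.le_succ hk) _ (by simp) (by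
    rw [Finset.mem_Icc] at hk
    omega)

theorem Generic.star_ne_delta_last {n : ℕ} (h : Generic rt K φ (n + 1)) :
    ∀ k ∈ Finset.Icc 1 n, DeltaStar rt K (φ k) ≠ Delta rt K (φ (n + 1)) := fun k hk =>
  (h.delta_ne_star _ (by simp) k (Finset.Icc_subset_Icc_right n.le_succ hk)).symm

/-- The first bilinear relation between `n` and `n + 1` solitons. -/
theorem bilinear_theta {n : ℕ} (h : Generic rt K φ (n + 1)) (g : ℕ → ℂ) (m : ℤ) :
    DeltaStar rt K (φ (n + 1)) * thetaPow rt K φ n g (m - 1) * tauPow rt K φ (n + 1) g m -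
        thetaPow rt K φ n g m * tauPow rt K φ (n + 1) g (m - 1) =
      (DeltaStar rt K (φ (n + 1)) - 1) * tauPow rt K φ n g (m - 1) *
        thetaPow rt K φ (n + 1) g m := by
  have hn : n + 1 ∈ Finset.Icc 1 (n + 1) := by simp
  have h' := h.mono n.le_succ
  have hs := h.sFun_one_mul hn
  have hr : DeltaStar rt K (φ (n + 1)) / Delta rt K (φ (n + 1)) * Delta rt K (φ (n + 1)) =
    DeltaStar rt K (φ (n + 1)) := div_mul_cancel₀ _ (h.delta_ne _ hn)
  -- Both sides are affine in g_{n+1}: the Fay identity at (1, Δ*_{φ_{n+1}}) gives the constant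
  -- part, the one at (1, Δ_{φ_{n+1}}) the coefficient.
  have h1 := tauPow_fay h' (fun k hk => h'.star_ne_one hk) h.star_ne_star_last g m
  have h2 := tauPow_fay h' (fun k hk => h'.star_ne_one hk) h.star_ne_delta_last g m
  simp only [thetaPow]
  rw [tauPow_succ h g m, tauPow_succ h g (m - 1), tauPow_succ h _ m,
    zpow_sub_one₀ (exp_ne_zero _)]
  rw [show (exp (2 * I * φ (n + 1)))⁻¹ = DeltaStar rt K (φ (n + 1)) / Delta rt K (φ (n + 1)) by
    rw [h.exp_eq _ hn, inv_div]]
  linear_combination h1 + g (n + 1) * ampFactor rt K φ n * exp (2 * I * φ (n + 1)) ^ m *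
    (-(DeltaStar rt K (φ (n + 1)) / Delta rt K (φ (n + 1))) * h2 +
      tauPow rt K φ n (fun k => g k * sFun rt K (φ k) 1) (m - 1) *
        tauPow rt K φ n (fun k => g k * sFun rt K (φ k) (Delta rt K (φ (n + 1)))) m * hr +
      tauPow rt K φ n g (m - 1) * tauPow rt K φ n
        (fun k => g k * sFun rt K (φ k) 1 * sFun rt K (φ k) (Delta rt K (φ (n + 1)))) m * hs)

/-- The second bilinear relation between `n` and `n + 1` solitons. -/
theorem bilinear_tau {n : ℕ} (h : Generic rt K φ (n + 1)) (g : ℕ → ℂ) (m : ℤ) :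
    DeltaStar rt K (φ (n + 1)) * thetaPow rt K φ n g (m - 1) * tauPow rt K φ (n + 1) g (m + 1) +
        K * thetaPow rt K φ n g m * tauPow rt K φ (n + 1) g m =
      Delta rt K (φ (n + 1)) * (DeltaStar rt K (φ (n + 1)) - 1) * tauPow rt K φ n g m *
        thetaPow rt K φ (n + 1) g m := by
  have hn : n + 1 ∈ Finset.Icc 1 (n + 1) := by simp
  have h' := h.mono n.le_succ
  have hs := h.sFun_one_mul hn
  have hc := h.curve _ hn
  have key : ∀ x, (∀ k ∈ Finset.Icc 1 n, DeltaStar rt K (φ k) ≠ x) →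
      x * thetaPow rt K φ n g (m - 1) *
          tauPow rt K φ n (fun k => g k * sFun rt K (φ k) x) (m + 1) +
        K * thetaPow rt K φ n g m * tauPow rt K φ n (fun k => g k * sFun rt K (φ k) x) m =
      (x + K) * tauPow rt K φ n g m *
        tauPow rt K φ n (fun k => g k * sFun rt K (φ k) 1 * sFun rt K (φ k) x) m := by
    intro x hx
    have h1 := tauPow_fay h' (fun k hk => h'.star_ne_neg hk) hx g (m + 1)
    have h2 : tauPow rt K φ n (fun k => g k * sFun rt K (φ k) (-K) * sFun rt K (φ k) x) (m + 1) =
        tauPow rt K φ n (fun k => g k * sFun rt K (φ k) 1 * sFun rt K (φ k) x) m := by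
      have h3 := tauPow_mul_sFun_neg h' (fun k => g k * sFun rt K (φ k) x) (m + 1)
      rw [thetaPow, add_sub_cancel_right] at h3
      rw [tauPow_congr _ fun k _ => mul_right_comm (g k) (sFun rt K (φ k) (-K)) (sFun rt K (φ k) x),
        h3]
      exact tauPow_congr _ fun k _ => mul_right_comm _ _ _
    rw [h2, tauPow_mul_sFun_neg h', tauPow_mul_sFun_neg h', add_sub_cancel_right] at h1
    linear_combination h1
  have h1 := key _ h.star_ne_star_last
  have h2 := key _ h.star_ne_delta_last
  have hr : Delta rt K (φ (n + 1)) * (DeltaStar rt K (φ (n + 1)) / Delta rt K (φ (n + 1))) =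
    DeltaStar rt K (φ (n + 1)) := mul_div_cancel₀ _ (h.delta_ne _ hn)
  have hq : DeltaStar rt K (φ (n + 1)) * exp (2 * I * φ (n + 1)) = Delta rt K (φ (n + 1)) := by
    rw [h.exp_eq _ hn, mul_div_cancel₀ _ (h.star_ne _ hn)]
  simp only [thetaPow] at h1 h2 ⊢
  rw [tauPow_succ h g m, tauPow_succ h g (m + 1), tauPow_succ h _ m,
    zpow_add_one₀ (exp_ne_zero _)]
  linear_combination h1 - tauPow rt K φ n g m * tauPow rt K φ n
      (fun k => g k * sFun rt K (φ k) 1 * sFun rt K (φ k) (DeltaStar rt K (φ (n + 1)))) m * hc +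
    g (n + 1) * ampFactor rt K φ n * exp (2 * I * φ (n + 1)) ^ m *
    (-h2 - tauPow rt K φ n (fun k => g k * sFun rt K (φ k) 1) (m - 1) *
        tauPow rt K φ n (fun k => g k * sFun rt K (φ k) (Delta rt K (φ (n + 1)))) (m + 1) * hq +
      tauPow rt K φ n g m * tauPow rt K φ n
        (fun k => g k * sFun rt K (φ k) 1 * sFun rt K (φ k) (Delta rt K (φ (n + 1)))) m *
        (Delta rt K (φ (n + 1)) * hs + (Delta rt K (φ (n + 1)) - 1) * hr + hc))

/-- The Casoratian of the two parts of `τ^{(n+1)}` that do not depend on `g_{n+1}`. -/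
theorem casoratian {n : ℕ} (h : Generic rt K φ (n + 1)) (g : ℕ → ℂ) (m : ℤ) :
    DeltaStar rt K (φ (n + 1)) *
        (tauPow rt K φ n (fun k => g k * sFun rt K (φ k) (Delta rt K (φ (n + 1)))) (m - 1) *
          tauPow rt K φ n (fun k => g k * sFun rt K (φ k) (DeltaStar rt K (φ (n + 1)))) m) -
      Delta rt K (φ (n + 1)) *
        (tauPow rt K φ n (fun k => g k * sFun rt K (φ k) (DeltaStar rt K (φ (n + 1)))) (m - 1) *
          tauPow rt K φ n (fun k => g k * sFun rt K (φ k) (Delta rt K (φ (n + 1)))) m) =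
      (DeltaStar rt K (φ (n + 1)) - Delta rt K (φ (n + 1))) *
        (thetaPow rt K φ n g (m - 1) * tauPow rt K φ n g (m - 1)) := by
  -- The Fay identity at (Δ*_{φ_{n+1}}, Δ_{φ_{n+1}}); the double twist collapses to θ at site m - 1
  -- by `Generic.sFun_mul_sFun`.
  rw [← tauPow_fay (h.mono n.le_succ) h.star_ne_star_last h.star_ne_delta_last g m, thetaPow,
    sub_eq_add_neg m 1, ← tauPow_mul_exp n (fun k => g k * sFun rt K (φ k) 1)]
  congr 2
  refine tauPow_congr m fun k hk => ?_
  rw [mul_assoc, h.sFun_mul_sFun (Finset.Icc_subset_Icc_right n.le_succ hk) (by simp) (by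
    rw [Finset.mem_Icc] at hk
    omega)]
  ring

end

/-! ### Admissible angles: general position and periodicity. -/

section
variable {rt : ℂ → ℂ} {K : ℂ} {φ : ℕ → ℝ}

theorem angleSet_bounds {M : ℕ} {x : ℝ} (hx : x ∈ angleSet M) : 0 < x ∧ x < Real.pi := by
  obtain ⟨k, h1, h2, rfl⟩ := hx
  have hk : (0 : ℝ) < k := by exact_mod_cast h1
  have hkM : (k : ℝ) < M := by exact_mod_cast h2
  have hM : (0 : ℝ) < M := hk.trans hkM
  have hpi := Real.pi_pos
  refine ⟨by positivity, ?_⟩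
  rw [div_lt_iff₀ hM]
  nlinarith

theorem exp_angle_zpow {M : ℕ} {x : ℝ} (hx : x ∈ angleSet M) :
    exp (2 * I * x) ^ (M : ℤ) = 1 := by
  obtain ⟨k, h1, h2, rfl⟩ := hx
  have hM : (M : ℂ) ≠ 0 := by
    norm_cast
    omega
  rw [zpow_natCast, ← exp_nat_mul, ← exp_nat_mul_two_pi_mul_I k]
  congr 1
  push_cast
  field_simp

theorem exp_two_I_mul_inj {x y : ℝ} (hx : 0 < x ∧ x < Real.pi) (hy : 0 < y ∧ y < Real.pi)
    (h : exp (2 * I * x) = exp (2 * I * y)) : x = y := by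
  obtain ⟨n, hn⟩ := exp_eq_exp_iff_exists_int.1 h
  have h1 : x = y + n * Real.pi := by
    have := congrArg im hn
    simp at this
    linarith
  have hpi := Real.pi_pos
  have h2 : n = 0 := by
    have h3 : (n : ℝ) < 1 := by nlinarith
    have h4 : (-1 : ℝ) < n := by nlinarith
    norm_cast at h3 h4
    omega
  simpa [h2] using h1

theorem add_eq_pi_of_exp_mul_eq_one {x y : ℝ} (hx : 0 < x ∧ x < Real.pi)
    (hy : 0 < y ∧ y < Real.pi) (h : exp (2 * I * x) * exp (2 * I * y) = 1) :
    x + y = Real.pi := by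
  have h1 : exp (2 * I * x) = exp (2 * I * (Real.pi - y : ℝ)) := by
    have h2 : exp (2 * I * (Real.pi - y : ℝ)) * exp (2 * I * y) = 1 := by
      rw [← exp_add, ← exp_two_pi_mul_I]
      congr 1
      push_cast
      ring
    exact mul_right_cancel₀ (exp_ne_zero _) (h.trans h2.symm)
  have := exp_two_I_mul_inj hx ⟨by linarith, by linarith⟩ h1
  linarith

theorem exp_add_exp_neg (x : ℝ) : exp (I * x) + exp (-(I * x)) = 2 * Real.cos x := by
  rw [ofReal_cos, Complex.cos]
  ring_nf

theorem delta_mul_deltaStar (hrt : ∀ z, rt z ^ 2 = z) (x : ℝ) :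
    Delta rt K x * DeltaStar rt K x = Delta rt K x + DeltaStar rt K x + K := by
  have h1 : exp (I * x) * exp (-(I * x)) = 1 := by rw [← exp_add]; simp
  have h2 := hrt ((Real.cos x : ℂ) ^ 2 + K)
  have h3 := exp_add_exp_neg x
  rw [Delta, DeltaStar]
  linear_combination (rt ((Real.cos x : ℂ) ^ 2 + K) + Real.cos x) ^ 2 * h1 + h2 -
    (rt ((Real.cos x : ℂ) ^ 2 + K) + Real.cos x) * h3

theorem rt_add_cos_ne_zero (hrt : ∀ z, rt z ^ 2 = z) (hK : K ≠ 0) (x : ℝ) :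
    rt ((Real.cos x : ℂ) ^ 2 + K) + Real.cos x ≠ 0 := by
  intro h
  apply hK
  linear_combination (rt ((Real.cos x : ℂ) ^ 2 + K) - Real.cos x) * h -
    hrt ((Real.cos x : ℂ) ^ 2 + K)

theorem exp_two_I_mul_eq (hrt : ∀ z, rt z ^ 2 = z) (hK : K ≠ 0) (x : ℝ) :
    exp (2 * I * x) = Delta rt K x / DeltaStar rt K x := by
  rw [Delta, DeltaStar, mul_div_mul_right _ _ (rt_add_cos_ne_zero hrt hK x), ← exp_sub]
  ring_nf

/-- As (Δ - 1)(Δ* - 1) = 1 + K ≠ 0, each of Δ, Δ* determines the other, and their ratio e^{2iφ}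
determines φ in (0, π). A coincidence Δ_j = Δ*_k forces φ_j + φ_k = π, and then the vanishing of the
excluded square root. -/
theorem generic_of_angleSet (hrt : ∀ z, rt z ^ 2 = z) (hK : K ≠ 0) (hK1 : K ≠ -1) {M : ℕ}
    (hKc : ∀ x ∈ angleSet M, (Real.cos x : ℂ) ^ 2 + K ≠ 0)
    (hφ : ∀ n ∈ Set.Icc 1 (M - 1), φ n ∈ angleSet M) (hφinj : Set.InjOn φ (Set.Icc 1 (M - 1))) :
    Generic rt K φ (M - 1) := by
  have hIcc : ∀ k ∈ Finset.Icc 1 (M - 1), k ∈ Set.Icc 1 (M - 1) := fun k hk => by simpa using hk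
  have hd : ∀ x, Delta rt K x ≠ 0 := fun x =>
    mul_ne_zero (exp_ne_zero _) (rt_add_cos_ne_zero hrt hK x)
  have hs : ∀ x, DeltaStar rt K x ≠ 0 := fun x =>
    mul_ne_zero (exp_ne_zero _) (rt_add_cos_ne_zero hrt hK x)
  have hc := delta_mul_deltaStar (K := K) hrt
  have hd1 : ∀ x, Delta rt K x - 1 ≠ 0 := fun x h => hK1 (by
    linear_combination (DeltaStar rt K x - 1) * h - hc x)
  have hs1 : ∀ x, DeltaStar rt K x - 1 ≠ 0 := fun x h => hK1 (by
    linear_combination (Delta rt K x - 1) * h - hc x)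
  refine ⟨fun k _ => hd _, fun k _ => hs _, fun k _ => hc _, hK1, ?_, ?_,
    fun k _ => exp_two_I_mul_eq hrt hK _⟩
  · intro j hj k hk hjk h
    have h1 : Delta rt K (φ j) = Delta rt K (φ k) := by
      apply mul_right_cancel₀ (hs1 (φ j))
      linear_combination hc (φ j) - hc (φ k) + (1 - Delta rt K (φ k)) * h
    apply hjk
    apply hφinj (hIcc j hj) (hIcc k hk)
    apply exp_two_I_mul_inj (angleSet_bounds (hφ j (hIcc j hj))) (angleSet_bounds (hφ k (hIcc k hk)))
    rw [exp_two_I_mul_eq hrt hK, exp_two_I_mul_eq hrt hK, h, h1]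
  · intro j hj k hk h
    have h1 : DeltaStar rt K (φ j) = Delta rt K (φ k) := by
      apply mul_right_cancel₀ (hd1 (φ j))
      linear_combination hc (φ j) - hc (φ k) + (1 - Delta rt K (φ k)) * h
    have h2 : φ j + φ k = Real.pi := by
      apply add_eq_pi_of_exp_mul_eq_one (angleSet_bounds (hφ j (hIcc j hj)))
        (angleSet_bounds (hφ k (hIcc k hk)))
      rw [exp_two_I_mul_eq hrt hK, exp_two_I_mul_eq hrt hK, h, h1]
      have := hd (φ k)
      have := hs (φ k)
      field_simp
    have h3 : φ k = Real.pi - φ j := by linarith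
    apply hKc (φ j) (hφ j (hIcc j hj))
    have h4 : exp (-(I * φ k)) = -exp (I * φ j) := by
      rw [h3, ← neg_one_mul (exp (I * φ j)), ← exp_neg_pi_mul_I, ← exp_add]
      congr 1
      push_cast
      ring
    rw [Delta, DeltaStar, h4] at h
    have h5 : (Real.cos (φ k) : ℂ) = -Real.cos (φ j) := by
      rw [h3, Real.cos_pi_sub]
      simp
    -- Both square roots now have the same argument, so they agree for any choice of branch.
    rw [h5, neg_sq] at h
    have h6 : exp (I * φ j) * rt ((Real.cos (φ j) : ℂ) ^ 2 + K) = 0 := by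
      linear_combination h / 2
    have h7 := (mul_eq_zero.1 h6).resolve_left (exp_ne_zero _)
    rw [← hrt ((Real.cos (φ j) : ℂ) ^ 2 + K), h7]
    simp

theorem tauPow_periodic {M n : ℕ} (hφ : ∀ k ∈ Finset.Icc 1 n, φ k ∈ angleSet M) (g : ℕ → ℂ) :
    Function.Periodic (tauPow rt K φ n g) (M : ℤ) := by
  intro m
  rw [← tauPow_mul_exp]
  exact tauPow_congr m fun k hk => by rw [exp_angle_zpow (hφ k hk), mul_one]

/-- `tauPow` as a function on `ℤ/M`. -/
def tauZ (rt : ℂ → ℂ) (K : ℂ) (φ : ℕ → ℝ) (M n : ℕ) (g : ℕ → ℂ) (m : ZMod M) : ℂ :=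
  tauPow rt K φ n g m.val

theorem tauPow_eq_tauZ {M n : ℕ} [NeZero M] (hφ : ∀ k ∈ Finset.Icc 1 n, φ k ∈ angleSet M)
    (g : ℕ → ℂ) (m : ℤ) : tauPow rt K φ n g m = tauZ rt K φ M n g (m : ZMod M) := by
  rw [tauZ, ZMod.val_intCast, Int.emod_def, mul_comm]
  exact ((tauPow_periodic hφ g).sub_int_mul_eq (m / M)).symm

theorem nonVanishing_iff {M n : ℕ} [NeZero M] (hφ : ∀ k ∈ Finset.Icc 1 n, φ k ∈ angleSet M)
    (g : ℕ → ℂ) : NonVanishing rt K φ n g ↔ ∀ m : ZMod M, tauZ rt K φ M n g m ≠ 0 ∧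
      tauZ rt K φ M n (fun k => g k * sFun rt K (φ k) 1) m ≠ 0 := by
  constructor
  · intro h m
    exact h m.val
  · intro h m
    rw [thetaPow, tauPow_eq_tauZ hφ, tauPow_eq_tauZ hφ]
    exact h m

/-! ### Generic amplitudes. -/

theorem continuous_Theta {X : Type*} [TopologicalSpace X] (n : ℕ) (F : X → ℕ → ℂ)
    (hF : ∀ k, Continuous fun x => F x k) (m : ℤ) :
    Continuous fun x => Theta rt K φ n (F x) m := by
  induction n generalizing F with
  | zero => exact continuous_const
  | succ n ih =>
    simp only [Theta]
    exact (ih F hF).sub (((hF _).mul continuous_const).mul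
      (ih _ fun k => continuous_const.mul (hF k)))

theorem continuous_tauPow {X : Type*} [TopologicalSpace X] (n : ℕ) (F : X → ℕ → ℂ)
    (hF : ∀ k, Continuous fun x => F x k) (m : ℤ) :
    Continuous fun x => tauPow rt K φ n (F x) m :=
  continuous_Theta n _ (fun k => (hF k).mul continuous_const) m

theorem exists_polynomial_Theta (n : ℕ) (f : ℕ → ℂ) (m : ℤ) : ∃ p : Polynomial ℂ,
    p.eval 0 = 1 ∧ ∀ t, p.eval t = Theta rt K φ n (fun k => t * f k) m := by
  induction n generalizing f with
  | zero => exact ⟨1, by simp, fun t => by simp [Theta]⟩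
  | succ n ih =>
    obtain ⟨p, hp, hpt⟩ := ih f
    obtain ⟨q, hq, hqt⟩ := ih fun k => phaseShift rt K (φ k) (φ (n + 1)) * f k
    refine ⟨p - Polynomial.X * Polynomial.C (f (n + 1) * exp (2 * I * m * φ (n + 1))) * q,
      by simp [hp], fun t => ?_⟩
    simp only [Theta, Polynomial.eval_sub, Polynomial.eval_mul, Polynomial.eval_X,
      Polynomial.eval_C, hpt, hqt]
    simp only [mul_assoc, mul_left_comm t]

theorem eventually_tauPow_ne_zero (n : ℕ) (g : ℕ → ℂ) (m : ℤ) :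
    ∀ᶠ t : ℂ in nhdsWithin 1 {1}ᶜ, tauPow rt K φ n (fun k => t * g k) m ≠ 0 := by
  obtain ⟨p, hp, hpt⟩ := exists_polynomial_Theta (rt := rt) (K := K) (φ := φ) n
    (freeAmplitude rt K φ n g) m
  have hp0 : p ≠ 0 := by
    rintro rfl
    simp at hp
  have h1 : ∀ᶠ t : ℂ in Filter.cofinite, ¬ p.IsRoot t :=
    Filter.eventually_cofinite.2 (by simpa using p.finite_setOfPred_isRoot hp0)
  filter_upwards [h1.filter_mono (nhdsNE_le_cofinite _)] with t ht h0
  apply ht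
  rw [Polynomial.IsRoot, hpt, ← h0, tauPow]
  exact Theta_congr m fun k _ => by rw [freeAmplitude, freeAmplitude, mul_assoc]

/-- Openness: by periodicity only finitely many continuous functions must be nonzero. Density: along
t ↦ tg each of them is a polynomial in t with value 1 at t = 0, hence nonzero for all t ≠ 1 close to
1. -/
theorem isOpen_dense_nonVanishing {M : ℕ} [NeZero M]
    (hφ : ∀ k ∈ Finset.Icc 1 (M - 1), φ k ∈ angleSet M) :
    IsOpen {g : ℕ → ℂ | ∀ n ≤ M - 1, NonVanishing rt K φ n g} ∧
      Dense {g : ℕ → ℂ | ∀ n ≤ M - 1, NonVanishing rt K φ n g} := by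
  have hset : {g : ℕ → ℂ | ∀ n ≤ M - 1, NonVanishing rt K φ n g} =
      {g | ∀ n ∈ Finset.range M, ∀ m : ZMod M, tauPow rt K φ n g m.val ≠ 0 ∧
        tauPow rt K φ n (fun k => g k * sFun rt K (φ k) 1) m.val ≠ 0} := by
    ext g
    have hM := NeZero.pos M
    have hiff : ∀ n, n ≤ M - 1 ↔ n ∈ Finset.range M := fun n => by
      rw [Finset.mem_range]
      omega
    simp only [Set.mem_ofPred_eq, hiff]
    refine forall₂_congr fun n hn => nonVanishing_iff (fun k hk => hφ k ?_) g
    exact Finset.Icc_subset_Icc_right ((hiff n).2 hn) hk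
  rw [hset]
  constructor
  · simp only [Set.ofPred_forall, Set.ofPred_and]
    refine isOpen_biInter_finset fun n _ => isOpen_iInter_of_finite fun m => ?_
    exact (isOpen_ne.preimage (continuous_tauPow n _ (fun k => continuous_apply k) _)).inter
      (isOpen_ne.preimage (continuous_tauPow n _
        (fun k => (continuous_apply k).mul continuous_const) _))
  · intro g
    have hev : ∀ᶠ t : ℂ in nhdsWithin 1 {1}ᶜ, (fun k => t * g k) ∈
        {g : ℕ → ℂ | ∀ n ∈ Finset.range M, ∀ m : ZMod M, tauPow rt K φ n g m.val ≠ 0 ∧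
          tauPow rt K φ n (fun k => g k * sFun rt K (φ k) 1) m.val ≠ 0} := by
      simp only [Set.mem_ofPred_eq]
      refine (Filter.eventually_all_finset _).2 fun n _ => Filter.eventually_all.2 fun m => ?_
      refine (eventually_tauPow_ne_zero n g _).and ?_
      filter_upwards [eventually_tauPow_ne_zero n (fun k => g k * sFun rt K (φ k) 1) m.val]
        with t ht
      simpa only [mul_assoc] using ht
    have htend : Filter.Tendsto (fun (t : ℂ) k => t * g k) (nhdsWithin 1 {1}ᶜ) (nhds g) := by
      have hcont : Continuous fun (t : ℂ) k => t * g k :=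
        continuous_pi fun k => continuous_id.mul continuous_const
      have := (hcont.tendsto 1).mono_left (nhdsWithin_le_nhds (s := {1}ᶜ))
      simpa using this
    exact mem_closure_of_tendsto htend hev

end

/-! ### Phases and products around the cycle. -/

theorem omegaHalf_pow (N : ℕ) [NeZero N] : omegaHalf N ^ N = -1 := by
  rw [omegaHalf, ← exp_nat_mul, ← exp_pi_mul_I]
  congr 1
  have : (N : ℂ) ≠ 0 := NeZero.ne _
  field_simp

theorem omegaHalf_ne_zero (N : ℕ) : omegaHalf N ≠ 0 := exp_ne_zero _

theorem prod_div_shift_eq_one {M : ℕ} [NeZero M] (t : ZMod M → ℂ) (ht : ∀ m, t m ≠ 0) :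
    ∏ m, t (m - 1) / t m = 1 := by
  have h : ∏ m, t (m - 1) = ∏ m, t m := Equiv.prod_comp (Equiv.subRight (1 : ZMod M)) t
  rw [Finset.prod_div_distrib, h]
  exact div_self (Finset.prod_ne_zero_iff.2 fun m _ => ht m)

theorem prod_range_zmod {M : ℕ} [NeZero M] (F : ZMod M → ℂ) :
    ∏ j ∈ Finset.range M, F (j : ℕ) = ∏ m, F m := by
  refine Finset.prod_bij' (fun j _ => (j : ZMod M)) (fun m _ => m.val) ?_ ?_ ?_ ?_ ?_
  · simp
  · exact fun m _ => Finset.mem_range.2 m.val_lt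
  · exact fun j hj => ZMod.val_cast_of_lt (Finset.mem_range.1 hj)
  · simp
  · simp

/-- A cyclic sequence of unit product whose `N`-th powers are quotients of neighbours is itself a
sequence of quotients of neighbours. -/
theorem exists_phases {N M : ℕ} [NeZero N] [NeZero M] (t v : ZMod M → ℂ) (ht : ∀ m, t m ≠ 0)
    (hv : ∀ m, v m ^ N = t (m - 1) / t m) (hprod : ∏ m, v m = 1) :
    ∃ τ : ZMod M → ℂ, (∀ m, τ m ^ N = t m) ∧ ∀ m, v m = τ (m - 1) / τ m := by
  obtain ⟨ρ, hρ⟩ := IsAlgClosed.exists_pow_nat_eq (t 0) (NeZero.pos N)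
  have hv0 : ∀ m, v m ≠ 0 := fun m h => by
    have := hv m
    rw [h, zero_pow (NeZero.ne N)] at this
    exact div_ne_zero (ht _) (ht _) this.symm
  -- The relation v_m = τ_{m-1}/τ_m forces this product once a root ρ at site 0 is chosen; the unit
  -- product of v makes it close up after M steps.
  let P : ℕ → ℂ := fun k => ρ / ∏ j ∈ Finset.range k, v ((j : ZMod M) + 1)
  have hP : ∀ k, P k ^ N = t k := by
    intro k
    induction k with
    | zero => simp [P, hρ]
    | succ k ih =>
      have h1 : P (k + 1) = P k / v ((k : ZMod M) + 1) := by
        simp only [P, Finset.prod_range_succ, div_div]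
      rw [h1, div_pow, ih, hv, add_sub_cancel_right]
      have := ht k
      push_cast
      field_simp
  have hρ0 : ρ ≠ 0 := fun h => ht 0 (by rw [← hρ, h, zero_pow (NeZero.ne N)])
  have hPM : P M = ρ := by
    have h : ∏ m, v (m + 1) = ∏ m, v m := Equiv.prod_comp (Equiv.addRight (1 : ZMod M)) v
    simp only [P]
    rw [prod_range_zmod fun m => v (m + 1), h, hprod, div_one]
  refine ⟨fun m => P m.val, fun m => by simp [hP], fun m => ?_⟩
  obtain ⟨k, hk, rfl⟩ : ∃ k : ℕ, k < M ∧ m = (k : ZMod M) + 1 :=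
    ⟨(m - 1).val, (m - 1).val_lt, by simp⟩
  have h1 : P ((k : ZMod M) + 1).val = P (k + 1) := by
    rcases Nat.lt_or_ge (k + 1) M with h | h
    · rw [← Nat.cast_succ, ZMod.val_cast_of_lt h]
    · have hkM : k + 1 = M := by omega
      rw [← Nat.cast_succ, Nat.succ_eq_add_one, hkM, ZMod.natCast_self, ZMod.val_zero, hPM]
      simp [P]
  have h2 : P k ≠ 0 := fun h => ht k (by rw [← hP, h, zero_pow (NeZero.ne N)])
  have h3 : P (k + 1) = P k / v ((k : ZMod M) + 1) := by
    simp only [P, Finset.prod_range_succ, div_div]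
  simp only [add_sub_cancel_right]
  rw [h1, ZMod.val_cast_of_lt hk, h3, div_div_cancel₀ h2]

/-! ### One Darboux step in bilinear form. -/

section Bilinear

variable {M : ℕ} {K a b ε : ℂ} {T S T' S' : ZMod M → ℂ}

/-- The bilinear relations between the functions of two successive solitonic states. -/
structure Bilinear (K a b : ℂ) (T S T' S' : ZMod M → ℂ) : Prop where
  a_ne : a ≠ 0
  b_ne : b ≠ 0
  b_ne_one : b - 1 ≠ 0
  curve : a * b = a + b + K
  T_ne : ∀ m, T m ≠ 0
  S_ne : ∀ m, S m ≠ 0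
  rel_S : ∀ m, b * S (m - 1) * T' m - S m * T' (m - 1) = (b - 1) * T (m - 1) * S' m
  rel_T : ∀ m, b * S (m - 1) * T' (m + 1) + K * S m * T' m = a * (b - 1) * T m * S' m

/-- Eliminating S' leaves a linear second-order recurrence for T', the linearization of the Riccati
recursion for u_φ^N. -/
theorem Bilinear.three_term (h : Bilinear K a b T S T' S') (m : ZMod M) :
    b * T (m - 1) * S (m - 1) * T' (m + 1) =
      (a * b * T m * S (m - 1) - K * T (m - 1) * S m) * T' m - a * S m * T m * T' (m - 1) := by
  linear_combination T (m - 1) * h.rel_T m - a * T m * h.rel_S m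

/-- Here ε stands for (-1)^N and X for u_φ^N at site m. The relation on X is kept free of division
so that it can be propagated before T' is known to be nonzero everywhere. -/
theorem Bilinear.den_u_eq (h : Bilinear K a b T S T' S') (hε : ε * ε = 1) {m : ZMod M} {X : ℂ}
    (hX : X * T' m = -ε * a * T' (m - 1)) :
    (a * b + K * (-ε * (T (m - 1) / T m)) * (ε * (S m / S (m - 1))) + ε * (S m / S (m - 1)) * X) *
      (T m * T' m) = b * T (m - 1) * T' (m + 1) := by
  have h1 := h.three_term m
  have h2 := h.T_ne m
  have h3 := h.S_ne (m - 1)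
  field_simp
  linear_combination -h1 + ε * T m * S m * hX +
    (-K * T (m - 1) * S m * T' m - a * T m * S m * T' (m - 1)) * hε

theorem Bilinear.den_w_eq (h : Bilinear K a b T S T' S') (hε : ε * ε = 1) {m : ZMod M} {X : ℂ}
    (hX : X * T' m = -ε * a * T' (m - 1)) :
    (a * b + ε * (S m / S (m - 1)) * X) * (S (m - 1) * T' m) =
      a * (b - 1) * T (m - 1) * S' m := by
  have h1 := h.rel_S m
  have h3 := h.S_ne (m - 1)
  field_simp
  linear_combination a * h1 + ε * S m * hX - a * S m * T' (m - 1) * hε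

end Bilinear

theorem neg_one_pow_mul_self (N : ℕ) : (-1 : ℂ) ^ N * (-1) ^ N = 1 := by
  rw [← mul_pow]
  simp

section Step

variable {N M : ℕ} {κ κφ lamφ a b : ℂ} {T S T' S' : ZMod M → ℂ} {uφ wφ u w u' w' : ZMod M → ℂ}

/-- By `Bilinear.den_u_eq` and `Bilinear.den_w_eq` the denominators are monomials in T, S, T', S',
hence nonzero, and each relation becomes a cancellation. -/
theorem Bilinear.isQTransformWith (h : Bilinear (κ ^ N) a b T S T' S') (hN : N ≠ 0) (hκ : κ ≠ 0)
    (hlam : lamφ ^ N = a * b) (hkap : κφ ^ N = κ ^ N / a)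
    (hT' : ∀ m, T' m ≠ 0) (hS' : ∀ m, S' m ≠ 0)
    (hu : ∀ m, u m ^ N = -(-1) ^ N * (T (m - 1) / T m))
    (hw : ∀ m, w m ^ N = (-1) ^ N * (S m / S (m - 1)))
    (huφ : ∀ m, uφ m ^ N = -(-1) ^ N * a * (T' (m - 1) / T' m))
    (hwφ : ∀ m, wφ m ^ N = -(S (m - 1) * T' (m - 1) / ((b - 1) * T (m - 1) * S' (m - 1))))
    (hu' : ∀ m, u' m ^ N = -(-1) ^ N * (T' (m - 1) / T' m))
    (hw' : ∀ m, w' m ^ N = (-1) ^ N * (S' m / S' (m - 1))) :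
    IsQTransformWith N M κ κφ lamφ uφ wφ u w u' w' := by
  have hε := neg_one_pow_mul_self N
  have hε0 : (-1 : ℂ) ^ N ≠ 0 := by simp
  have hK : κ ^ N ≠ 0 := pow_ne_zero _ hκ
  have ha := h.a_ne
  have hb := h.b_ne
  have hb1 := h.b_ne_one
  have hT := h.T_ne
  have hS := h.S_ne
  have hX : ∀ m, -(-1) ^ N * a * (T' (m - 1) / T' m) * T' m = -(-1) ^ N * a * T' (m - 1) :=
    fun m => by rw [mul_assoc, div_mul_cancel₀ _ (hT' m)]
  have hDu := fun m => h.den_u_eq hε (hX m)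
  have hDw := fun m => h.den_w_eq hε (hX m)
  have hDu0 : ∀ m, lamφ ^ N + κ ^ N * u m ^ N * w m ^ N + w m ^ N * uφ m ^ N ≠ 0 := fun m h0 => by
    rw [hlam, hu, hw, huφ] at h0
    have := hDu m
    rw [h0, zero_mul] at this
    exact mul_ne_zero (mul_ne_zero hb (hT _)) (hT' _) this.symm
  have hDw0 : ∀ m, lamφ ^ N + w m ^ N * uφ m ^ N ≠ 0 := fun m h0 => by
    rw [hlam, hw, huφ] at h0
    have := hDw m
    rw [h0, zero_mul] at this
    exact mul_ne_zero (mul_ne_zero (mul_ne_zero ha hb1) (hT _)) (hS' _) this.symm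
  refine ⟨fun m h0 => ?_, fun m h0 => ?_, hDu0, hDw0, fun m => ?_, fun m => ?_, fun m => ?_,
    fun m => ?_⟩
  · have := huφ m
    rw [h0, zero_pow hN] at this
    exact mul_ne_zero (mul_ne_zero (neg_ne_zero.2 hε0) ha) (div_ne_zero (hT' _) (hT' _)) this.symm
  · have := hwφ m
    rw [h0, zero_pow hN] at this
    exact neg_ne_zero.2 (div_ne_zero (mul_ne_zero (hS _) (hT' _))
      (mul_ne_zero (mul_ne_zero hb1 (hT _)) (hS' _))) this.symm
  · rw [eq_div_iff (hDu0 m)]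
    have h1 := hDu m
    rw [hlam, hu, hw, huφ, huφ, add_sub_cancel_right]
    have := hT m
    have := hT' m
    have := hT' (m + 1)
    apply mul_right_cancel₀ (mul_ne_zero (hT m) (hT' m))
    rw [mul_assoc, h1]
    field_simp
  · have h1 := hDw m
    have := hT m
    have := hT (m - 1)
    have := hS (m - 1)
    have := hS' m
    have := hT' m
    rw [← mul_div_assoc, eq_div_iff (hDw0 m), hkap, hlam, hu, hw, huφ, hwφ, add_sub_cancel_right]
    apply mul_right_cancel₀ (mul_ne_zero (hS (m - 1)) (hT' m))
    rw [mul_assoc, h1]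
    field_simp
    linear_combination S m * hε
  · rw [hu', huφ, hkap]
    field_simp
  · rw [hw', hu, hw, huφ, hwφ, hwφ, hkap, add_sub_cancel_right]
    have := hT m
    have := hT (m - 1)
    have := hS m
    have := hS (m - 1)
    have := hS' m
    have := hS' (m - 1)
    have := hT' m
    have := hT' (m - 1)
    field_simp

/-- The recursion for u_φ^N is of first order, so agreement with the bilinear solution at site 1
spreads around the cycle. Nonvanishing of T' and S' is not assumed beyond T'_1: it follows from that
of the denominators. -/
theorem Bilinear.of_isQTransformWith [NeZero M] (h : Bilinear (κ ^ N) a b T S T' S')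
    (hκ : κ ≠ 0) (hlam : lamφ ^ N = a * b) (hkap : κφ ^ N = κ ^ N / a)
    (hu : ∀ m, u m ^ N = -(-1) ^ N * (T (m - 1) / T m))
    (hw : ∀ m, w m ^ N = (-1) ^ N * (S m / S (m - 1)))
    (hQ : IsQTransformWith N M κ κφ lamφ uφ wφ u w u' w')
    (h1 : T' 1 ≠ 0) (hX1 : uφ 1 ^ N * T' 1 = -(-1) ^ N * a * T' 0) :
    (∀ m, T' m ≠ 0 ∧ S' m ≠ 0) ∧ (∀ m, u' m ^ N = -(-1) ^ N * (T' (m - 1) / T' m)) ∧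
      ∀ m, w' m ^ N = (-1) ^ N * (S' m / S' (m - 1)) := by
  have hε := neg_one_pow_mul_self N
  have hε0 : (-1 : ℂ) ^ N ≠ 0 := by simp
  have hK : κ ^ N ≠ 0 := pow_ne_zero _ hκ
  have ha := h.a_ne
  have hb := h.b_ne
  have hb1 := h.b_ne_one
  have hT := h.T_ne
  have hS := h.S_ne
  have hstep : ∀ m, T' m ≠ 0 → uφ m ^ N * T' m = -(-1) ^ N * a * T' (m - 1) →
      T' (m + 1) ≠ 0 ∧ uφ (m + 1) ^ N * T' (m + 1) = -(-1) ^ N * a * T' m := by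
    intro m hm hX
    have hDu := h.den_u_eq hε hX
    rw [← hlam, ← hu, ← hw] at hDu
    have hD0 := hQ.den_u m
    have hrec := hQ.rec_u m
    rw [eq_div_iff hD0] at hrec
    refine ⟨fun h0 => ?_, ?_⟩
    · rw [h0, mul_zero] at hDu
      exact mul_ne_zero hD0 (mul_ne_zero (hT m) hm) hDu
    · have hUT : u m ^ N * T m = -(-1) ^ N * T (m - 1) := by
        rw [hu, mul_assoc, div_mul_cancel₀ _ (hT m)]
      apply mul_left_cancel₀ (mul_ne_zero hb (hT (m - 1)))
      linear_combination -uφ (m + 1) ^ N * hDu + T m * T' m * hrec + lamφ ^ N * T' m * hUT -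
        (-1) ^ N * T (m - 1) * T' m * hlam
  have key : ∀ m, T' m ≠ 0 ∧ uφ m ^ N * T' m = -(-1) ^ N * a * T' (m - 1) := by
    -- The induction runs over sites k + 1, which reach every residue from the initial site 1.
    have hnat : ∀ k : ℕ, T' ((k : ZMod M) + 1) ≠ 0 ∧ uφ ((k : ZMod M) + 1) ^ N *
        T' ((k : ZMod M) + 1) = -(-1) ^ N * a * T' ((k : ZMod M) + 1 - 1) := by
      intro k
      induction k with
      | zero =>
        rw [Nat.cast_zero, zero_add, sub_self]
        exact ⟨h1, hX1⟩
      | succ k ih =>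
        rw [add_sub_cancel_right, Nat.cast_succ]
        exact hstep _ ih.1 ih.2
    intro m
    have := hnat (m - 1).val
    rwa [ZMod.natCast_zmod_val, sub_add_cancel] at this
  have hX : ∀ m, uφ m ^ N = -(-1) ^ N * a * (T' (m - 1) / T' m) := fun m => by
    rw [← mul_div_assoc, eq_div_iff (key m).1, (key m).2]
  have hDw := fun m => h.den_w_eq hε (key m).2
  have hS' : ∀ m, S' m ≠ 0 := fun m h0 => by
    have h2 := hDw m
    rw [← hlam, ← hw, h0, mul_zero] at h2
    exact mul_ne_zero (hQ.den_w m) (mul_ne_zero (hS _) (key m).1) h2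
  have hY : ∀ m, wφ (m + 1) ^ N = -(S m * T' m / ((b - 1) * T m * S' m)) := fun m => by
    have h2 := hDw m
    have hDw0 := hQ.den_w m
    rw [hQ.rec_w, ← mul_div_assoc, div_eq_iff hDw0]
    rw [← hlam, ← hw] at h2
    have := hT m
    have := hT (m - 1)
    have := hS (m - 1)
    have := hS' m
    have := (key m).1
    apply mul_right_cancel₀ (mul_ne_zero (hS (m - 1)) (key m).1)
    rw [mul_assoc _ (lamφ ^ N + _), h2, hkap, hu, hw]
    field_simp
    linear_combination -S m * hε
  refine ⟨fun m => ⟨(key m).1, hS' m⟩, fun m => ?_, fun m => ?_⟩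
  · rw [hQ.out_u, hX, hkap]
    field_simp
  · have hYm := hY (m - 1)
    rw [sub_add_cancel] at hYm
    rw [hQ.out_w, hY, hYm, hu, hw, hX, hkap]
    have := hT m
    have := hT (m - 1)
    have := hS m
    have := hS (m - 1)
    have := hS' m
    have := hS' (m - 1)
    have := (key m).1
    have := (key (m - 1)).1
    field_simp

end Step

/-! ### Solitonic states and their N-th powers. -/

section Soliton

variable {rt : ℂ → ℂ} {K : ℂ} {φ : ℕ → ℝ} {N M n : ℕ} [NeZero N] [NeZero M]
  {g : ℕ → ℂ} {u w : ZMod M → ℂ}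

theorem IsSoliton.pow_eq (hφ : ∀ k ∈ Finset.Icc 1 n, φ k ∈ angleSet M)
    (h : IsSoliton rt K N M φ n g u w) (m : ZMod M) :
    u m ^ N = -(-1) ^ N * (tauZ rt K φ M n g (m - 1) / tauZ rt K φ M n g m) ∧
    w m ^ N = (-1) ^ N * (tauZ rt K φ M n (fun k => g k * sFun rt K (φ k) 1) m /
      tauZ rt K φ M n (fun k => g k * sFun rt K (φ k) 1) (m - 1)) := by
  obtain ⟨τ, θ, hτ, hθ, hu, hw⟩ := h
  have hτ' : ∀ m, τ m ^ N = tauZ rt K φ M n g m := fun m => by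
    obtain ⟨z, rfl⟩ := ZMod.intCast_surjective m
    rw [hτ, tauPow_eq_tauZ hφ]
  have hθ' : ∀ m, θ m ^ N = tauZ rt K φ M n (fun k => g k * sFun rt K (φ k) 1) m := fun m => by
    obtain ⟨z, rfl⟩ := ZMod.intCast_surjective m
    rw [hθ, thetaPow, tauPow_eq_tauZ hφ]
  constructor
  · rw [hu, mul_pow, neg_pow, inv_pow, omegaHalf_pow, div_pow, hτ', hτ']
    norm_num
  · rw [hw, neg_pow, div_pow, hθ', hθ']

theorem IsSoliton.isGaugeFixed (h : IsSoliton rt K N M φ n g u w) (hg : NonVanishing rt K φ n g) : IsGaugeFixed N M u w := by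
  obtain ⟨τ, θ, hτ, hθ, hu, hw⟩ := h
  have hτ' : ∀ m, τ m ≠ 0 := fun m h0 => by
    obtain ⟨z, rfl⟩ := ZMod.intCast_surjective m
    exact (hg z).1 (by rw [← hτ, h0, zero_pow (NeZero.ne N)])
  have hθ' : ∀ m, θ m ≠ 0 := fun m h0 => by
    obtain ⟨z, rfl⟩ := ZMod.intCast_surjective m
    exact (hg z).2 (by rw [← hθ, h0, zero_pow (NeZero.ne N)])
  constructor
  · rw [← prod_div_shift_eq_one τ hτ']
    refine Finset.prod_congr rfl fun m _ => ?_
    rw [hu]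
    have := omegaHalf_ne_zero N
    field_simp
  · have h1 := congrArg (·⁻¹) (prod_div_shift_eq_one θ hθ')
    simp only [← Finset.prod_inv_distrib, inv_one, inv_div] at h1
    rw [← h1]
    refine Finset.prod_congr rfl fun m _ => ?_
    rw [hw, neg_neg]

/-- The gauge normalization is exactly the unit-product condition under which `exists_phases` yields
cyclic τ and θ. -/
theorem isSoliton_of_pow_eq (hφ : ∀ k ∈ Finset.Icc 1 n, φ k ∈ angleSet M)
    (hg : NonVanishing rt K φ n g) (hgauge : IsGaugeFixed N M u w)
    (hu : ∀ m, u m ^ N = -(-1) ^ N * (tauZ rt K φ M n g (m - 1) / tauZ rt K φ M n g m))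
    (hw : ∀ m, w m ^ N = (-1) ^ N * (tauZ rt K φ M n (fun k => g k * sFun rt K (φ k) 1) m /
      tauZ rt K φ M n (fun k => g k * sFun rt K (φ k) 1) (m - 1))) :
    IsSoliton rt K N M φ n g u w := by
  have hg' := (nonVanishing_iff hφ g).1 hg
  have hε := neg_one_pow_mul_self N
  obtain ⟨τ, hτ, hτu⟩ := exists_phases (N := N) (tauZ rt K φ M n g)
    (fun m => -omegaHalf N * u m) (fun m => (hg' m).1)
    (fun m => by
      rw [mul_pow, neg_pow, omegaHalf_pow, hu]
      linear_combination (tauZ rt K φ M n g (m - 1) / tauZ rt K φ M n g m) * hε) hgauge.1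
  obtain ⟨θ, hθ, hθw⟩ := exists_phases (N := N)
    (tauZ rt K φ M n fun k => g k * sFun rt K (φ k) 1)
    (fun m => (-w m)⁻¹) (fun m => (hg' m).2)
    (fun m => by
      rw [inv_pow, neg_pow, hw, ← mul_assoc, hε, one_mul, inv_div])
    (by rw [Finset.prod_inv_distrib, hgauge.2, inv_one])
  refine ⟨τ, θ, fun m => by rw [hτ, tauPow_eq_tauZ hφ],
    fun m => by rw [hθ, thetaPow, tauPow_eq_tauZ hφ], fun m => ?_, fun m => ?_⟩
  · rw [← hτu]
    have := omegaHalf_ne_zero N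
    field_simp
  · rw [← inv_div, ← hθw, inv_inv, neg_neg]

theorem Generic.bilinear {M : ℕ} [NeZero M] (h : Generic rt K φ (n + 1))
    (hφ : ∀ k ∈ Finset.Icc 1 (n + 1), φ k ∈ angleSet M) (hg : NonVanishing rt K φ n g) :
    Bilinear (M := M) K (Delta rt K (φ (n + 1))) (DeltaStar rt K (φ (n + 1)))
      (tauZ rt K φ M n g) (tauZ rt K φ M n fun k => g k * sFun rt K (φ k) 1)
      (tauZ rt K φ M (n + 1) g) (tauZ rt K φ M (n + 1) fun k => g k * sFun rt K (φ k) 1) := by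
  have hn : n + 1 ∈ Finset.Icc 1 (n + 1) := by simp
  have hφ' : ∀ k ∈ Finset.Icc 1 n, φ k ∈ angleSet M := fun k hk =>
    hφ k (Finset.Icc_subset_Icc_right n.le_succ hk)
  have hg' := (nonVanishing_iff hφ' g).1 hg
  refine ⟨h.delta_ne _ hn, h.star_ne _ hn, sub_ne_zero.2 (h.star_ne_one hn), h.curve _ hn,
    fun m => (hg' m).1, fun m => (hg' m).2, fun m => ?_, fun m => ?_⟩
  · obtain ⟨z, rfl⟩ := ZMod.intCast_surjective m
    have := bilinear_theta h g z
    simp only [thetaPow] at this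
    simp only [tauPow_eq_tauZ hφ, tauPow_eq_tauZ hφ'] at this
    push_cast at this
    exact this
  · obtain ⟨z, rfl⟩ := ZMod.intCast_surjective m
    have := bilinear_tau h g z
    simp only [thetaPow] at this
    simp only [tauPow_eq_tauZ hφ, tauPow_eq_tauZ hφ'] at this
    push_cast at this
    exact this

end Soliton

theorem isSoliton_zero (rt : ℂ → ℂ) (K : ℂ) (N M : ℕ) (φ : ℕ → ℝ) (g : ℕ → ℂ) : IsSoliton rt K N M φ 0 g
    (fun _ => -(omegaHalf N)⁻¹) (fun _ => -1) :=
  ⟨fun _ => 1, fun _ => 1, fun _ => one_pow N, fun _ => one_pow N, by simp, by simp⟩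

/-! ### Adding a soliton and recovering its amplitude. -/

section

variable {rt : ℂ → ℂ} {φ : ℕ → ℝ} {N M n : ℕ} [NeZero N] [NeZero M] {κ κφ lamφ : ℂ}

theorem IsSoliton.isQTransform {g : ℕ → ℂ} {u w u' w' : ZMod M → ℂ}
    (h : Generic rt (κ ^ N) φ (n + 1)) (hφ : ∀ k ∈ Finset.Icc 1 (n + 1), φ k ∈ angleSet M)
    (hκ : κ ≠ 0) (hlam : lamφ ^ N = Lam rt (κ ^ N) (φ (n + 1)))
    (hkap : κφ ^ N = κ ^ N / Delta rt (κ ^ N) (φ (n + 1)))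
    (hg : NonVanishing rt (κ ^ N) φ n g) (hg' : NonVanishing rt (κ ^ N) φ (n + 1) g)
    (hs : IsSoliton rt (κ ^ N) N M φ n g u w)
    (hs' : IsSoliton rt (κ ^ N) N M φ (n + 1) g u' w') :
    IsQTransform N M κ κφ lamφ u w u' w' := by
  have hφ' : ∀ k ∈ Finset.Icc 1 n, φ k ∈ angleSet M := fun k hk =>
    hφ k (Finset.Icc_subset_Icc_right n.le_succ hk)
  -- All relations are between N-th powers, so arbitrary N-th roots of the prescribed values serve
  -- as auxiliary variables.
  have hroot : ∀ F : ZMod M → ℂ, ∃ f : ZMod M → ℂ, ∀ m, f m ^ N = F m := fun F =>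
    Classical.skolem.1 fun m => IsAlgClosed.exists_pow_nat_eq (F m) (NeZero.pos N)
  have hnv := (nonVanishing_iff hφ g).1 hg'
  obtain ⟨uφ, huφ⟩ := hroot _
  obtain ⟨wφ, hwφ⟩ := hroot _
  exact ⟨uφ, wφ, (h.bilinear hφ hg).isQTransformWith (NeZero.ne N) hκ hlam hkap
    (fun m => (hnv m).1) (fun m => (hnv m).2) (fun m => (hs.pow_eq hφ' m).1)
    (fun m => (hs.pow_eq hφ' m).2) huφ hwφ (fun m => (hs'.pow_eq hφ m).1)
    (fun m => (hs'.pow_eq hφ m).2)⟩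

theorem tauPow_update_succ {K : ℂ} (h : Generic rt K φ (n + 1)) (g : ℕ → ℂ) (γ : ℂ) (m : ℤ) :
    tauPow rt K φ (n + 1) (Function.update g (n + 1) γ) m =
      tauPow rt K φ n (fun k => g k * sFun rt K (φ k) (DeltaStar rt K (φ (n + 1)))) m -
      γ * (ampFactor rt K φ n * exp (2 * I * φ (n + 1)) ^ m *
        tauPow rt K φ n (fun k => g k * sFun rt K (φ k) (Delta rt K (φ (n + 1)))) m) := by
  have hne : ∀ k ∈ Finset.Icc 1 n, Function.update g (n + 1) γ k = g k := fun k hk =>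
    Function.update_of_ne (by rw [Finset.mem_Icc] at hk; omega) _ _
  rw [tauPow_succ h, Function.update_self,
    tauPow_congr m fun k hk => congrArg (· * sFun rt K (φ k) (DeltaStar rt K (φ (n + 1)))) (hne k hk),
    tauPow_congr m fun k hk => congrArg (· * sFun rt K (φ k) (Delta rt K (φ (n + 1)))) (hne k hk)]
  ring

/-- The amplitude of the new soliton is determined by the ratio of two neighbouring values of
`τ^N`, with the exception of one value of the ratio. -/
theorem exists_amplitude {K : ℂ} (h : Generic rt K φ (n + 1)) {g : ℕ → ℂ}
    (hg : NonVanishing rt K φ n g) : ∃ e : ℂ, ∀ X : ℂ, X ≠ e → ∃ γ : ℂ,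
      tauPow rt K φ (n + 1) (Function.update g (n + 1) γ) 1 ≠ 0 ∧
      ∀ γ', X * tauPow rt K φ (n + 1) (Function.update g (n + 1) γ') 1 =
        Delta rt K (φ (n + 1)) * tauPow rt K φ (n + 1) (Function.update g (n + 1) γ') 0 ↔
          γ' = γ := by
  have hn : n + 1 ∈ Finset.Icc 1 (n + 1) := by simp
  have ha := h.delta_ne _ hn
  have hc := ampFactor_ne_zero h
  have hcas := casoratian h g 1
  have hq : exp (2 * I * φ (n + 1)) * DeltaStar rt K (φ (n + 1)) = Delta rt K (φ (n + 1)) := by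
    rw [h.exp_eq _ hn, div_mul_cancel₀ _ (h.star_ne _ hn)]
  have hq0 := exp_ne_zero (2 * I * φ (n + 1))
  have hW := mul_ne_zero (sub_ne_zero.2 (h.delta_ne_star _ hn _ hn).symm)
    (mul_ne_zero (hg 0).2 (hg 0).1)
  simp only [tauPow_update_succ h]
  rw [sub_self] at hcas
  rw [← hcas] at hW
  clear hcas
  simp only [zpow_zero, zpow_one]
  generalize tauPow rt K φ n (fun k => g k * sFun rt K (φ k) (Delta rt K (φ (n + 1)))) 0 = B0 at *
  generalize tauPow rt K φ n (fun k => g k * sFun rt K (φ k) (Delta rt K (φ (n + 1)))) 1 = B1 at *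
  generalize tauPow rt K φ n
    (fun k => g k * sFun rt K (φ k) (DeltaStar rt K (φ (n + 1)))) 0 = A0 at *
  generalize tauPow rt K φ n
    (fun k => g k * sFun rt K (φ k) (DeltaStar rt K (φ (n + 1)))) 1 = A1 at *
  generalize Delta rt K (φ (n + 1)) = a at *
  generalize DeltaStar rt K (φ (n + 1)) = b at *
  generalize exp (2 * I * φ (n + 1)) = q at *
  generalize ampFactor rt K φ n = c at *
  -- The excluded value is that of aτ_0/τ_1 (N-th powers) at γ = ∞. If B1 = 0 the quotient is 0 by
  -- convention; no value needs excluding then, as the Casoratian forces B0 ≠ 0.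
  refine ⟨a * B0 / (q * B1), fun X hX => ?_⟩
  have hD : X * (q * B1) - a * B0 ≠ 0 := by
    intro h0
    by_cases hB1 : B1 = 0
    · have hB0 : B0 = 0 := by
        rw [hB1] at h0
        simpa [ha] using h0
      exact hW (by rw [hB0, hB1]; ring)
    · exact hX (by rw [eq_div_iff (mul_ne_zero hq0 hB1)]; linear_combination h0)
  have hiff : ∀ γ, X * (A1 - γ * (c * q * B1)) = a * (A0 - γ * (c * 1 * B0)) ↔
      γ = (X * A1 - a * A0) / (c * (X * (q * B1) - a * B0)) := by
    intro γ
    rw [eq_div_iff (mul_ne_zero hc hD)]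
    constructor <;> intro h1 <;> linear_combination -h1
  -- If τ_1^N vanished at γ, so would τ_0^N; two affine functions of γ with a common root have zero
  -- Casoratian.
  refine ⟨_, fun h0 => ?_, hiff⟩
  have h1 := (hiff _).2 rfl
  rw [h0, mul_zero, eq_comm, mul_eq_zero] at h1
  have h2 := h1.resolve_left ha
  generalize (X * A1 - a * A0) / (c * (X * (q * B1) - a * B0)) = γ at *
  apply hW
  linear_combination b * B0 * h0 - a * B1 * h2 + γ * c * B0 * B1 * hq

theorem IsSoliton.existsUnique_amplitude
    (h : Generic rt (κ ^ N) φ (n + 1)) (hφ : ∀ k ∈ Finset.Icc 1 (n + 1), φ k ∈ angleSet M)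
    (hκ : κ ≠ 0) (hlam : lamφ ^ N = Lam rt (κ ^ N) (φ (n + 1)))
    (hkap : κφ ^ N = κ ^ N / Delta rt (κ ^ N) (φ (n + 1))) {g : ℕ → ℂ}
    (hg : NonVanishing rt (κ ^ N) φ n g) :
    ∃ e : ℂ, ∀ u w uφ wφ u' w' : ZMod M → ℂ, IsSoliton rt (κ ^ N) N M φ n g u w →
      IsQTransformWith N M κ κφ lamφ uφ wφ u w u' w' → IsGaugeFixed N M u' w' → uφ 1 ^ N ≠ e →
      ∃! γ : ℂ, NonVanishing rt (κ ^ N) φ (n + 1) (Function.update g (n + 1) γ) ∧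
        IsSoliton rt (κ ^ N) N M φ (n + 1) (Function.update g (n + 1) γ) u' w' := by
  have hn : n + 1 ∈ Finset.Icc 1 (n + 1) := by simp
  have ha := h.delta_ne _ hn
  have hK : κ ^ N ≠ 0 := pow_ne_zero _ hκ
  have hε := neg_one_pow_mul_self N
  have hε0 : (-1 : ℂ) ^ N ≠ 0 := by simp
  have hφ' : ∀ k ∈ Finset.Icc 1 n, φ k ∈ angleSet M := fun k hk =>
    hφ k (Finset.Icc_subset_Icc_right n.le_succ hk)
  obtain ⟨e, he⟩ := exists_amplitude h hg
  -- The ratio in `exists_amplitude` is -(-1)^N u_φ^N, and this sign is its own inverse.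
  refine ⟨-(-1) ^ N * e, fun u w uφ wφ u' w' hs hQ hgauge hne => ?_⟩
  obtain ⟨γ, hγ, hγ'⟩ := he (-(-1) ^ N * uφ 1 ^ N) fun h0 => hne (by
    rw [← h0]
    linear_combination -(uφ 1 ^ N) * hε)
  have hne : ∀ γ, ∀ k ∈ Finset.Icc 1 n, Function.update g (n + 1) γ k = g k := fun γ k hk =>
    Function.update_of_ne (by rw [Finset.mem_Icc] at hk; omega) _ _
  have hcast1 := fun γ => tauPow_eq_tauZ (rt := rt) (K := κ ^ N) hφ (Function.update g (n + 1) γ) 1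
  have hcast0 := fun γ => tauPow_eq_tauZ (rt := rt) (K := κ ^ N) hφ (Function.update g (n + 1) γ) 0
  simp only [Int.cast_one, Int.cast_zero] at hcast1 hcast0
  simp only [hcast1, hcast0] at hγ hγ'
  have htau : ∀ m, tauPow rt (κ ^ N) φ n (Function.update g (n + 1) γ) m =
      tauPow rt (κ ^ N) φ n g m := fun m => tauPow_congr m (hne γ)
  have htheta : ∀ m, thetaPow rt (κ ^ N) φ n (Function.update g (n + 1) γ) m =
      thetaPow rt (κ ^ N) φ n g m := fun m =>
    tauPow_congr m fun k hk => by rw [hne γ k hk]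
  have hg' : NonVanishing rt (κ ^ N) φ n (Function.update g (n + 1) γ) := fun m => by
    rw [htau, htheta]
    exact hg m
  have hs' : IsSoliton rt (κ ^ N) N M φ n (Function.update g (n + 1) γ) u w := by
    simpa only [IsSoliton, htau, htheta] using hs
  refine ⟨γ, ?_, ?_⟩
  · obtain ⟨h1, h2, h3⟩ := (h.bilinear hφ hg').of_isQTransformWith hκ hlam hkap
      (fun m => (hs'.pow_eq hφ' m).1) (fun m => (hs'.pow_eq hφ' m).2) hQ hγ (by
        linear_combination -(-1) ^ N * (hγ' γ).2 rfl -
          uφ 1 ^ N * tauZ rt (κ ^ N) φ M (n + 1) (Function.update g (n + 1) γ) 1 * hε)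
    have hnv := (nonVanishing_iff hφ _).2 h1
    exact ⟨hnv, isSoliton_of_pow_eq hφ hnv hgauge h2 h3⟩
  -- An n + 1-solitonic image fixes u'_1^N, hence u_φ^N at site 1, hence the ratio that determines
  -- the amplitude.
  · rintro γ' ⟨hnv, hsol⟩
    rw [← hγ']
    have h1 := (hsol.pow_eq hφ 1).1
    have h0 := ((nonVanishing_iff hφ _).1 hnv 1).1
    rw [hQ.out_u, hkap, sub_self] at h1
    field_simp at h1
    linear_combination -(-1) ^ N * h1 +
      Delta rt (κ ^ N) (φ (n + 1)) *
        tauZ rt (κ ^ N) φ M (n + 1) (Function.update g (n + 1) γ') 0 * hε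

end

end TodaChain

end

/-! ### The sequence of solitonic states. -/

theorem mainTheorem4 (N M : ℕ) [NeZero N] [NeZero M]
    (rt : ℂ → ℂ) (hrt : ∀ z, rt z ^ 2 = z)
    (κ : ℂ) (hκ0 : κ ≠ 0) (hκ1 : κ ^ N ≠ -1)
    (hκ : ∀ x ∈ TodaChain.angleSet M, (Real.cos x : ℂ) ^ 2 + κ ^ N ≠ 0)
    (φ : ℕ → ℝ) (hφ : ∀ n ∈ Set.Icc 1 (M - 1), φ n ∈ TodaChain.angleSet M)
    (hφinj : Set.InjOn φ (Set.Icc 1 (M - 1)))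
    (lam kap : ℕ → ℂ)
    (hlam : ∀ n ∈ Set.Icc 1 (M - 1), lam n ^ N = TodaChain.Lam rt (κ ^ N) (φ n))
    (hkap : ∀ n ∈ Set.Icc 1 (M - 1), kap n ^ N = κ ^ N / TodaChain.Delta rt (κ ^ N) (φ n)) :
    -- the amplitudes for which no `τ`, `θ` vanishes are generic
    (IsOpen {g : ℕ → ℂ | ∀ n ≤ M - 1, TodaChain.NonVanishing rt (κ ^ N) φ n g} ∧
      Dense {g : ℕ → ℂ | ∀ n ≤ M - 1, TodaChain.NonVanishing rt (κ ^ N) φ n g}) ∧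
    -- for all such amplitudes and all phases the solitonic states form a sequence of
    -- Q-transformations that starts at the homogeneous state
    (∀ g : ℕ → ℂ, (∀ n ≤ M - 1, TodaChain.NonVanishing rt (κ ^ N) φ n g) →
      ∀ u w : ℕ → ZMod M → ℂ,
        (∀ m, u 0 m = -(TodaChain.omegaHalf N)⁻¹) → (∀ m, w 0 m = -1) →
        (∀ n ∈ Set.Icc 1 (M - 1), TodaChain.IsSoliton rt (κ ^ N) N M φ n g (u n) (w n)) →
        ∀ n ∈ Set.Icc 1 (M - 1),
          TodaChain.IsGaugeFixed N M (u n) (w n) ∧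
          TodaChain.IsQTransform N M κ (kap n) (lam n) (u (n - 1)) (w (n - 1)) (u n) (w n)) ∧
    -- the homogeneous state is the 0-solitonic one
    (∀ g : ℕ → ℂ, TodaChain.IsSoliton rt (κ ^ N) N M φ 0 g
      (fun _ => -(TodaChain.omegaHalf N)⁻¹) (fun _ => -1)) ∧
    -- conversely, the `n`-th Q-transformation sends an `(n-1)`-solitonic state to an `n`-solitonic
    -- one with the same `g_1, …, g_{n-1}` and a unique new amplitude `g_n`, with the exception of
    -- at most one value of the auxiliary variable
    (∀ n ∈ Set.Icc 1 (M - 1), ∀ g : ℕ → ℂ, TodaChain.NonVanishing rt (κ ^ N) φ (n - 1) g →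
      ∃ e : ℂ, ∀ u w uφ wφ u' w' : ZMod M → ℂ,
        TodaChain.IsSoliton rt (κ ^ N) N M φ (n - 1) g u w →
        TodaChain.IsQTransformWith N M κ (kap n) (lam n) uφ wφ u w u' w' →
        TodaChain.IsGaugeFixed N M u' w' →
        uφ 1 ^ N ≠ e →
        ∃! γ : ℂ, TodaChain.NonVanishing rt (κ ^ N) φ n (Function.update g n γ) ∧
          TodaChain.IsSoliton rt (κ ^ N) N M φ n (Function.update g n γ) u' w') := by
  have hgen := TodaChain.generic_of_angleSet hrt (pow_ne_zero N hκ0) hκ1 hκ hφ hφinj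
  have hφn : ∀ n ≤ M - 1, ∀ k ∈ Finset.Icc 1 n, φ k ∈ TodaChain.angleSet M := fun n hn k hk => by
    rw [Finset.mem_Icc] at hk
    exact hφ k ⟨hk.1, hk.2.trans hn⟩
  refine ⟨TodaChain.isOpen_dense_nonVanishing (hφn _ le_rfl), ?_,
    TodaChain.isSoliton_zero rt (κ ^ N) N M φ, ?_⟩
  · intro g hg u w hu hw hsol n hn
    have hmem := hn
    obtain ⟨n, rfl⟩ := Nat.exists_eq_succ_of_ne_zero (Nat.one_le_iff_ne_zero.1 hn.1)
    have hprev : TodaChain.IsSoliton rt (κ ^ N) N M φ n g (u n) (w n) := by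
      rcases Nat.eq_zero_or_pos n with rfl | hpos
      · have h0 := TodaChain.isSoliton_zero rt (κ ^ N) N M φ g
        rwa [← funext hu, ← funext hw] at h0
      · exact hsol n ⟨hpos, n.le_succ.trans hn.2⟩
    exact ⟨(hsol _ hmem).isGaugeFixed (hg _ hn.2),
      hprev.isQTransform (hgen.mono hn.2) (hφn _ hn.2) hκ0 (hlam _ hmem) (hkap _ hmem)
        (hg n (n.le_succ.trans hn.2)) (hg _ hn.2) (hsol _ hmem)⟩
  · intro n hn g hg
    have hmem := hn
    obtain ⟨n, rfl⟩ := Nat.exists_eq_succ_of_ne_zero (Nat.one_le_iff_ne_zero.1 hn.1)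
    exact TodaChain.IsSoliton.existsUnique_amplitude (hgen.mono hn.2) (hφn _ hn.2) hκ0
      (hlam _ hmem) (hkap _ hmem) hg
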